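/- **Theorem (strong completeness of FOFS-D with respect to serial frames).** Let $\sigma$ be a signature consisting of a countably infinite set of constants and a countable set of predicate symbols of positive arity. Formulas are built from atoms $P(t_1,\dots,t_n)$ and $s\equiv t$ (terms are constants or variables $v_0,v_1,\dots$) and $\bot$ by $\land,\lor,\to,\Box,\Diamond,\forall x,\exists x$, with $\neg\varphi:=\varphi\to\bot$ and $\top:=\neg\bot$. Let $\Gamma$ be a set of sentences and $\varphi$ a sentence. If $\Gamma\Vdash\varphi$ over all FOFS models whose modal relation is serial, then $\Gamma\vdash\varphi$ in FOFS-D. *The logic.* The theorems of FOFS-D are the sentences generated as follows, where $\varphi,\psi$ are sentences, $\varphi(x),\psi(x)$ are formulas with no free variable other than $x$, and $c,c_1,c_2$ are constants. Axioms: substitution instances (by sentences) of theorems of intuitionistic propositional logic; $\Box(\varphi\land\psi)\leftrightarrow(\Box\varphi\land\Box\psi)$; $\Box\top$; $\Diamond(\varphi\lor\psi)\leftrightarrow(\Diamond\varphi\lor\Diamond\psi)$; $\neg\Diamond\bot$; $(\Diamond\varphi\to\Box\psi)\to\Box(\varphi\to\psi)$; $\Diamond(\varphi\to\psi)\to(\Box\varphi\to\Diamond\psi)$;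 $\forall x\varphi(x)\to\varphi(c)$; $\varphi(c)\to\exists x\varphi(x)$; $\forall x(\varphi(x)\to\psi)\to(\exists x\varphi(x)\to\psi)$; $\forall x(\varphi\to\psi(x))\to(\varphi\to\forall x\psi(x))$; $c\equiv c$; $c_1\equiv c_2\to(\varphi(c_1)\to\varphi(c_2))$ for $\varphi(x)$ without $\Box,\Diamond$; and $\Box\varphi\to\Diamond\varphi$. Rules: modus ponens; from $\varphi(c)$ infer $\forall x\varphi(x)$ if $c$ does not occur in $\varphi(x)$; from $\varphi\to\psi$ infer $\Box\varphi\to\Box\psi$ and $\Diamond\varphi\to\Diamond\psi$. We write $\Gamma\vdash\varphi$ if $\bigwedge_i\gamma_i\to\varphi$ is a theorem for some finite list of sentences $\gamma_i\in\Gamma$. *Models.* An FOFS frame consists of a set $W$, a partial order $\preccurlyeq$ and a relation $M$ on $W$ such that (FC1) if $w\,M\,v\preccurlyeq v'$ then there is $w'$ with $w\preccurlyeq w'\,M\,v'$, and (FC2) if $w\preccurlyeq w'$ and $w\,M\,v$ then there is $v'$ with $v\preccurlyeq v'$ and $w'\,M\,v'$; sets $D(w)$ for $w\in W$ that grow along both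 $\preccurlyeq$ and $M$; and equivalence relations $\sim_w$ on $D(w)$ that grow along $\preccurlyeq$. A model adds, for each constant $c$, an element $I(c)$ lying in every $D(w)$, and for each $n$-ary $P$ and each $w$ a set $I_w(P)\subseteq D(w)^n$ that grows along $\preccurlyeq$ and is closed under $\sim_w$ coordinatewise. The modal relation is serial if every $w$ has some $v$ with $w\,M\,v$. For $g$ an assignment of elements of $D(w)$ to the variables, truth $w\Vdash_g\varphi$ is defined by: $w\Vdash_g P(\bar t)$ iff the denotation of $\bar t$ is in $I_w(P)$; $w\Vdash_g s\equiv t$ iff the denotations are $\sim_w$-equivalent; the usual clauses at $w$ for $\land,\lor,\bot$; $w\Vdash_g\varphi\to\psi$ iff for all $w'\succcurlyeq w$, $w'\not\Vdash_g\varphi$ or $w'\Vdash_g\psi$; $w\Vdash_g\Box\varphi$ iff $v'\Vdash_g\varphi$ whenever $w\preccurlyeq w'\,M\,v'$; $w\Vdash_g\Diamond\varphi$ iff $v\Vdash_g\varphi$ for some $v$ with $w\,M\,v$; $w\Vdash_g\forall x\varphi$ iff $w'\Vdash_{g[x:=a]}\varphi$ for all $w'\succcurlyeq w$ and $a\in D(w')$;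 $w\Vdash_g\exists x\varphi$ iff $w\Vdash_{g[x:=a]}\varphi$ for some $a\in D(w)$. A sentence is true at $w$ if it is true there under every such $g$. Finally, $\Gamma\Vdash\varphi$ over a class of models means that at every world of every model of the class at which all members of $\Gamma$ are true, $\varphi$ is true. -/

import Mathlib

universe u

namespace FOFS

/-- A signature: a countably infinite set of constants and a countable set of predicate symbols
with positive arities. -/
structure Signature where
  Const : Type u
  Pred : Type u
  arity : Pred → ℕ
  arity_pos : ∀ P, 0 < arity P
  const_countable : Countable Const
  const_infinite : Infinite Const
  pred_countable : Countable Pred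

/-- Terms: variables `v₀, v₁, …` and constants. -/
inductive Term (σ : Signature.{u}) : Type u
  | var (x : ℕ) : Term σ
  | const (c : σ.Const) : Term σ

inductive Formula (σ : Signature.{u}) : Type u
  | rel (P : σ.Pred) (ts : Fin (σ.arity P) → Term σ) : Formula σ
  | eq (s t : Term σ) : Formula σ
  | and (φ ψ : Formula σ) : Formula σ
  | or (φ ψ : Formula σ) : Formula σ
  | imp (φ ψ : Formula σ) : Formula σ
  | box (φ : Formula σ) : Formula σ
  | dia (φ : Formula σ) : Formula σ
  | all (x : ℕ) (φ : Formula σ) : Formula σ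
  | ex (x : ℕ) (φ : Formula σ) : Formula σ
  | bot : Formula σ

namespace Term

variable {σ : Signature.{u}}

def vars : Term σ → Set ℕ
  | var x => {x}
  | const _ => ∅

def consts : Term σ → Set σ.Const
  | var _ => ∅
  | const c => {c}

/-- Replace the variable `x` by the constant `c`. -/
def inst (x : ℕ) (c : σ.Const) : Term σ → Term σ
  | var y => if y = x then const c else var y
  | const d => const d

end Term

namespace Formula

variable {σ : Signature.{u}}

def neg (φ : Formula σ) : Formula σ := imp φ bot

def top : Formula σ := neg bot

def iff (φ ψ : Formula σ) : Formula σ := and (imp φ ψ) (imp ψ φ)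

def freeVars : Formula σ → Set ℕ
  | rel _ ts => ⋃ i, (ts i).vars
  | eq s t => s.vars ∪ t.vars
  | and φ ψ => φ.freeVars ∪ ψ.freeVars
  | or φ ψ => φ.freeVars ∪ ψ.freeVars
  | imp φ ψ => φ.freeVars ∪ ψ.freeVars
  | box φ => φ.freeVars
  | dia φ => φ.freeVars
  | all x φ => φ.freeVars \ {x}
  | ex x φ => φ.freeVars \ {x}
  | bot => ∅

def consts : Formula σ → Set σ.Const
  | rel _ ts => ⋃ i, (ts i).consts
  | eq s t => s.consts ∪ t.consts
  | and φ ψ => φ.consts ∪ ψ.consts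
  | or φ ψ => φ.consts ∪ ψ.consts
  | imp φ ψ => φ.consts ∪ ψ.consts
  | box φ => φ.consts
  | dia φ => φ.consts
  | all _ φ => φ.consts
  | ex _ φ => φ.consts
  | bot => ∅

/-- Replace every free occurrence of the variable `x` by the constant `c`. -/
def inst (x : ℕ) (c : σ.Const) : Formula σ → Formula σ
  | rel P ts => rel P fun i => (ts i).inst x c
  | eq s t => eq (s.inst x c) (t.inst x c)
  | and φ ψ => and (φ.inst x c) (ψ.inst x c)
  | or φ ψ => or (φ.inst x c) (ψ.inst x c)
  | imp φ ψ => imp (φ.inst x c) (ψ.inst x c)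
  | box φ => box (φ.inst x c)
  | dia φ => dia (φ.inst x c)
  | all y φ => if y = x then all y φ else all y (φ.inst x c)
  | ex y φ => if y = x then ex y φ else ex y (φ.inst x c)
  | bot => bot

def ModalFree : Formula σ → Prop
  | rel _ _ => True
  | eq _ _ => True
  | and φ ψ => φ.ModalFree ∧ ψ.ModalFree
  | or φ ψ => φ.ModalFree ∧ ψ.ModalFree
  | imp φ ψ => φ.ModalFree ∧ ψ.ModalFree
  | box _ => False
  | dia _ => False
  | all _ φ => φ.ModalFree
  | ex _ φ => φ.ModalFree
  | bot => True

def IsSentence (φ : Formula σ) : Prop := φ.freeVars = ∅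

/-- `φ = φ(x)` has no free variable other than `x` (`x` need not occur, so that the quantifier
axioms and rules also govern vacuous quantification). -/
def OnePlace (x : ℕ) (φ : Formula σ) : Prop := φ.freeVars ⊆ {x}

/-- The conjunction of a finite list of formulas. -/
def conj : List (Formula σ) → Formula σ
  | [] => top
  | φ :: l => and φ (conj l)

end Formula

/-- Formulas of intuitionistic propositional logic. -/
inductive PropFormula : Type
  | atom (n : ℕ) : PropFormula
  | and (a b : PropFormula) : PropFormula
  | or (a b : PropFormula) : PropFormula
  | imp (a b : PropFormula) : PropFormula
  | bot : PropFormula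

/-- Substitution of formulas of the first-order modal language for propositional atoms. -/
def PropFormula.subst {σ : Signature.{u}} (s : ℕ → Formula σ) : PropFormula → Formula σ
  | atom n => s n
  | and a b => .and (a.subst s) (b.subst s)
  | or a b => .or (a.subst s) (b.subst s)
  | imp a b => .imp (a.subst s) (b.subst s)
  | bot => .bot

open PropFormula in
/-- Theorems of the intuitionistic propositional calculus, by the usual Hilbert system. -/
inductive IPC : PropFormula → Prop
  | k (a b) : IPC (imp a (imp b a))
  | s (a b c) : IPC (imp (imp a (imp b c)) (imp (imp a b) (imp a c)))
  | andLeft (a b) : IPC (imp (and a b) a)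
  | andRight (a b) : IPC (imp (and a b) b)
  | andIntro (a b) : IPC (imp a (imp b (and a b)))
  | orLeft (a b) : IPC (imp a (or a b))
  | orRight (a b) : IPC (imp b (or a b))
  | orElim (a b c) : IPC (imp (imp a c) (imp (imp b c) (imp (or a b) c)))
  | botElim (a) : IPC (imp bot a)
  | mp {a b} : IPC (imp a b) → IPC a → IPC b

open Formula in
/-- Theorems of the logic `FOFS ⊕ A`, where `A` is a set of additional axioms.  In `gen`, the
formula `φ` is what results from `φ(c)` by replacing *every* occurrence of `c` by `x`, no such
occurrence lying in the scope of a quantifier that binds `x`. -/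
inductive Provable {σ : Signature.{u}} (A : Set (Formula σ)) : Formula σ → Prop
  | extra {φ} : φ ∈ A → Provable A φ
  | int {a : PropFormula} {s : ℕ → Formula σ} :
      IPC a → (∀ n, IsSentence (s n)) → Provable A (a.subst s)
  | boxAnd {φ ψ} : IsSentence φ → IsSentence ψ →
      Provable A (iff (box (and φ ψ)) (and (box φ) (box ψ)))
  | boxTop : Provable A (box top)
  | diaOr {φ ψ} : IsSentence φ → IsSentence ψ →
      Provable A (iff (dia (or φ ψ)) (or (dia φ) (dia ψ)))
  | diaBot : Provable A (neg (dia bot))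
  | fs1 {φ ψ} : IsSentence φ → IsSentence ψ →
      Provable A (imp (imp (dia φ) (box ψ)) (box (imp φ ψ)))
  | fs2 {φ ψ} : IsSentence φ → IsSentence ψ →
      Provable A (imp (dia (imp φ ψ)) (imp (box φ) (dia ψ)))
  | univ {x φ} (c : σ.Const) : OnePlace x φ → Provable A (imp (all x φ) (φ.inst x c))
  | exist {x φ} (c : σ.Const) : OnePlace x φ → Provable A (imp (φ.inst x c) (ex x φ))
  | allAnt {x φ ψ} : OnePlace x φ → IsSentence ψ →
      Provable A (imp (all x (imp φ ψ)) (imp (ex x φ) ψ))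
  | allCon {x φ ψ} : IsSentence φ → OnePlace x ψ →
      Provable A (imp (all x (imp φ ψ)) (imp φ (all x ψ)))
  | idRef (c : σ.Const) : Provable A (eq (.const c) (.const c))
  | idSub {x φ} (c₁ c₂ : σ.Const) : OnePlace x φ → ModalFree φ →
      Provable A (imp (eq (.const c₁) (.const c₂)) (imp (φ.inst x c₁) (φ.inst x c₂)))
  | mp {φ ψ} : Provable A (imp φ ψ) → Provable A φ → Provable A ψ
  | gen {x φ} {c : σ.Const} : OnePlace x φ → c ∉ φ.consts →
      Provable A (φ.inst x c) → Provable A (all x φ)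
  | regBox {φ ψ} : Provable A (imp φ ψ) → Provable A (imp (box φ) (box ψ))
  | regDia {φ ψ} : Provable A (imp φ ψ) → Provable A (imp (dia φ) (dia ψ))

/-- `Γ ⊢ φ` in `FOFS ⊕ A`: some finite conjunction of members of `Γ` provably implies `φ`. -/
def Derives {σ : Signature.{u}} (A : Set (Formula σ)) (Γ : Set (Formula σ)) (φ : Formula σ) :
    Prop :=
  ∃ l : List (Formula σ), (∀ γ ∈ l, γ ∈ Γ) ∧ Provable A (.imp (Formula.conj l) φ)

/-- The instances `□φ → ◇φ`, for sentences `φ`. -/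
def axiomD (σ : Signature.{u}) : Set (Formula σ) :=
  {χ | ∃ φ : Formula σ, φ.IsSentence ∧ χ = .imp (.box φ) (.dia φ)}

/-- Fischer Servi frames. -/
structure FSFrame where
  World : Type u
  le : World → World → Prop
  acc : World → World → Prop
  le_refl : ∀ w, le w w
  le_trans : ∀ w w' w'', le w w' → le w' w'' → le w w''
  le_antisymm : ∀ w w', le w w' → le w' w → w = w'
  fc1 : ∀ w v v', acc w v → le v v' → ∃ w', le w w' ∧ acc w' v'
  fc2 : ∀ w w' v, le w w' → acc w v → ∃ v', le v v' ∧ acc w' v'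

/-- `FOFS` frames: Fischer Servi frames with a domain system.  All the domains are subsets of an
ambient type `Elem`, and `eqv w` is an equivalence relation on the set `dom w`. -/
structure Frame extends FSFrame.{u} where
  Elem : Type u
  dom : World → Set Elem
  dom_le : ∀ w w', le w w' → dom w ⊆ dom w'
  dom_acc : ∀ w v, acc w v → dom w ⊆ dom v
  eqv : World → Elem → Elem → Prop
  eqv_dom : ∀ w a b, eqv w a b → a ∈ dom w ∧ b ∈ dom w
  eqv_refl : ∀ w, ∀ a ∈ dom w, eqv w a a
  eqv_symm : ∀ w a b, eqv w a b → eqv w b a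
  eqv_trans : ∀ w a b c, eqv w a b → eqv w b c → eqv w a c
  eqv_le : ∀ w w' a b, le w w' → eqv w a b → eqv w' a b

/-- The modal relation of the frame is serial. -/
def Frame.Serial (F : Frame.{u}) : Prop := ∀ w, ∃ v, F.acc w v

/-- `FOFS` models over a signature: `FOFS` frames with an interpretation. -/
structure Model (σ : Signature.{u}) extends Frame.{u} where
  cst : σ.Const → Elem
  cst_mem : ∀ c w, cst c ∈ dom w
  rel : World → (P : σ.Pred) → Set (Fin (σ.arity P) → Elem)
  rel_dom : ∀ w P, ∀ a ∈ rel w P, ∀ i, a i ∈ dom w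
  rel_le : ∀ w w' P, le w w' → rel w P ⊆ rel w' P
  rel_eqv : ∀ w P a b, (∀ i, eqv w (a i) (b i)) → a ∈ rel w P → b ∈ rel w P

namespace Model

variable {σ : Signature.{u}} (M : Model σ)

/-- Denotation of a term under a variable assignment. -/
def den (g : ℕ → M.Elem) : Term σ → M.Elem
  | .var x => g x
  | .const c => M.cst c

/-- `g` is a `w`-variable assignment. -/
def IsAssignment (w : M.World) (g : ℕ → M.Elem) : Prop := ∀ x, g x ∈ M.dom w

/-- Truth of a formula at a world relative to an assignment. -/
def Sat : M.World → (ℕ → M.Elem) → Formula σ → Prop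
  | w, g, .rel P ts => (fun i => M.den g (ts i)) ∈ M.rel w P
  | w, g, .eq s t => M.eqv w (M.den g s) (M.den g t)
  | w, g, .and φ ψ => Sat w g φ ∧ Sat w g ψ
  | w, g, .or φ ψ => Sat w g φ ∨ Sat w g ψ
  | w, g, .imp φ ψ => ∀ w', M.le w w' → Sat w' g φ → Sat w' g ψ
  | w, g, .box φ => ∀ w' v', M.le w w' → M.acc w' v' → Sat v' g φ
  | w, g, .dia φ => ∃ v, M.acc w v ∧ Sat v g φ
  | w, g, .all x φ => ∀ w', M.le w w' → ∀ a ∈ M.dom w', Sat w' (Function.update g x a) φ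
  | w, g, .ex x φ => ∃ a ∈ M.dom w, Sat w (Function.update g x a) φ
  | _, _, .bot => False

/-- Truth at a world: truth under all `w`-variable assignments. -/
def TrueAt (w : M.World) (φ : Formula σ) : Prop := ∀ g, M.IsAssignment w g → M.Sat w g φ

end Model

/-- Local semantic consequence over the class of models whose frame satisfies `C`. -/
def Entails {σ : Signature.{u}} (C : Frame.{u} → Prop) (Γ : Set (Formula σ)) (φ : Formula σ) :
    Prop :=
  ∀ M : Model σ, C M.toFrame → ∀ w : M.World, (∀ γ ∈ Γ, M.TrueAt w γ) → M.TrueAt w φ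

end FOFS

/-! The proof builds a canonical model whose worlds are not single theories but finite chains `T 0,
…, T k` of prime theories with witnesses, each a modal successor of the one before; truth at the
world is membership in `T k`. A modal step appends a theory, and an intuitionistic step enlarges all
members of the chain at once. (FC1) then holds by deleting the last theory of the larger chain.
(FC2) asks for a successor of an enlarged theory above a given successor, which
`exists_step_extension` supplies.

The price is paid in the truth lemma for →, □ and ∀: the last theory cannot be enlarged alone, since
its predecessors must grow with it. `Chain.exists_extension` solves this by prescribing what to
omit. To omit an ideal `O` at level k+1, one omits at level k every sentence that implies □χ for
some χ in `O` (`OmitIdeal.pred`). The level k theory is chosen maximal with this property. If δ lies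
in the new last theory but ◇δ is not in its predecessor, maximality gives ◇δ → □χ there, hence □(δ →
χ) by the Fischer Servi axiom `fs1`, and χ would not be omitted.

Witnesses need constants that are new to the theory being extended and, at each level, to the
theories before it. The countable set of constants is therefore split by level and stage: the i-th
theory at stage N uses the levels up to i and the stages up to N. Constants of the wrong level or a
later stage are removed from a sentence by existential quantification (`exists_quantified`), so the
sets to be omitted must be closed under it. The given language is embedded as level 0, stage 0;
proofs are brought back by renaming constants (`Provable.rename`).

Seriality is the one point where □φ → ◇φ is applied: □⊤ belongs to every theory, hence so does ◇⊤.
-/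

namespace FOFS

variable {σ : Signature.{u}}

/-! ### Substitution of constants for variables, and of variables for constants -/

namespace Term

/-- Rename constants by `f` and replace the variables in the domain of `e` by constants. -/
def close (f : σ.Const → σ.Const) (e : ℕ → Option σ.Const) : Term σ → Term σ
  | var x => (e x).elim (var x) const
  | const c => const (f c)

open Classical in
/-- Replace the constant `c` by the variable `x`. -/
noncomputable def abstr (c : σ.Const) (x : ℕ) : Term σ → Term σ
  | var y => var y
  | const d => if d = c then var x else const d

theorem consts_finite (t : Term σ) : t.consts.Finite := by
  cases t <;> simp [consts]

theorem vars_inst (x : ℕ) (c : σ.Const) (t : Term σ) : (t.inst x c).vars = t.vars \ {x} := by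
  cases t with
  | var y =>
    by_cases h : y = x
    · simp [inst, vars, h]
    · ext z; simp only [inst, vars, h, if_false]; grind
  | const d => simp [inst, vars]

theorem inst_of_notMem {x : ℕ} (c : σ.Const) {t : Term σ} (h : x ∉ t.vars) : t.inst x c = t := by
  cases t with
  | var y => simp only [vars, Set.mem_singleton_iff] at h; simp [inst, Ne.symm h]
  | const d => rfl

theorem consts_inst_subset (x : ℕ) (c : σ.Const) (t : Term σ) :
    (t.inst x c).consts ⊆ insert c t.consts := by
  cases t with
  | var y => by_cases h : y = x <;> simp [inst, consts, h]
  | const d => simp [inst, consts]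

theorem consts_subset_inst (x : ℕ) (c : σ.Const) (t : Term σ) : t.consts ⊆ (t.inst x c).consts := by
  cases t with
  | var y => simp [consts]
  | const d => simp [inst, consts]

theorem vars_close (f : σ.Const → σ.Const) (e : ℕ → Option σ.Const) (t : Term σ) :
    (t.close f e).vars = t.vars ∩ {x | e x = none} := by
  cases t with
  | var y =>
    rcases h : e y with _ | c
    · ext z; simp only [close, h, vars, Option.elim]; grind
    · ext z; simp only [close, h, vars, Option.elim]; grind
  | const d => simp [close, vars]

theorem consts_close_subset {f : σ.Const → σ.Const} {e : ℕ → Option σ.Const} {C : Set σ.Const}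
    (hf : ∀ c, f c ∈ C) (he : ∀ x, ∀ c ∈ e x, c ∈ C) (t : Term σ) : (t.close f e).consts ⊆ C := by
  cases t with
  | var y =>
    rcases h : e y with _ | c
    · simp [close, h, consts]
    · simpa [close, h, consts] using he y c (by simp [h])
  | const d => simpa [close, consts] using hf d

theorem close_congr {f f' : σ.Const → σ.Const} {e e' : ℕ → Option σ.Const} {t : Term σ}
    (hf : ∀ c ∈ t.consts, f c = f' c) (he : ∀ x ∈ t.vars, e x = e' x) :
    t.close f e = t.close f' e' := by
  cases t with
  | var y => simp [close, he y (by simp [vars])]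
  | const d => simp [close, hf d (by simp [consts])]

theorem close_id (t : Term σ) : t.close id (fun _ => none) = t := by
  cases t <;> simp [close]

theorem inst_close (f : σ.Const → σ.Const) (e : ℕ → Option σ.Const) (x : ℕ) (c : σ.Const)
    (t : Term σ) (he : e x = none) :
    (t.close f e).inst x c = t.close f (Function.update e x (some c)) := by
  cases t with
  | var y =>
    by_cases hy : y = x
    · subst hy; simp [close, inst, he]
    · rcases h : e y with _ | d <;> simp [close, inst, h, hy, Function.update_of_ne]
  | const d => simp [close, inst]

theorem close_inst (f : σ.Const → σ.Const) (x : ℕ) (c : σ.Const) (t : Term σ) :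
    (t.inst x c).close f (fun _ => none) = (t.close f (fun _ => none)).inst x (f c) := by
  cases t with
  | var y => by_cases hy : y = x <;> simp [close, inst, hy]
  | const d => simp [close, inst]

theorem close_close (f g : σ.Const → σ.Const) (t : Term σ) :
    (t.close f (fun _ => none)).close g (fun _ => none) = t.close (g ∘ f) (fun _ => none) := by
  cases t <;> simp [close]

theorem inst_abstr {c : σ.Const} {x : ℕ} {t : Term σ} (h : x ∉ t.vars) :
    (t.abstr c x).inst x c = t := by
  cases t with
  | var y => simp only [vars, Set.mem_singleton_iff] at h; simp [abstr, inst, Ne.symm h]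
  | const d => by_cases hd : d = c <;> simp [abstr, inst, hd]

theorem vars_abstr_subset (c : σ.Const) (x : ℕ) (t : Term σ) :
    (t.abstr c x).vars ⊆ insert x t.vars := by
  cases t with
  | var y => simp [abstr, vars]
  | const d => by_cases hd : d = c <;> simp [abstr, vars, hd]

theorem consts_abstr (c : σ.Const) (x : ℕ) (t : Term σ) :
    (t.abstr c x).consts = t.consts \ {c} := by
  cases t with
  | var y => simp [abstr, consts]
  | const d =>
    by_cases hd : d = c
    · simp [abstr, consts, hd]
    · ext z; simp only [abstr, consts, hd, if_false]; grind

theorem exists_vars_bound (t : Term σ) : ∃ n, ∀ x, n ≤ x → x ∉ t.vars := by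
  cases t with
  | var y => exact ⟨y + 1, fun x hx => by simp only [vars, Set.mem_singleton_iff]; omega⟩
  | const d => exact ⟨0, fun x _ => by simp [vars]⟩

end Term

namespace Formula

/-- Rename constants by `f` and replace the free variables in the domain of `e` by constants. -/
def close (f : σ.Const → σ.Const) : (ℕ → Option σ.Const) → Formula σ → Formula σ
  | e, rel P ts => rel P fun i => (ts i).close f e
  | e, eq s t => eq (s.close f e) (t.close f e)
  | e, and φ ψ => and (φ.close f e) (ψ.close f e)
  | e, or φ ψ => or (φ.close f e) (ψ.close f e)
  | e, imp φ ψ => imp (φ.close f e) (ψ.close f e)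
  | e, box φ => box (φ.close f e)
  | e, dia φ => dia (φ.close f e)
  | e, all x φ => all x (φ.close f (Function.update e x none))
  | e, ex x φ => ex x (φ.close f (Function.update e x none))
  | _, bot => bot

/-- Rename constants. -/
abbrev rename (f : σ.Const → σ.Const) (φ : Formula σ) : Formula σ := φ.close f fun _ => none

/-- Replace every occurrence of the constant `c` by the variable `x`. -/
noncomputable def abstr (c : σ.Const) (x : ℕ) : Formula σ → Formula σ
  | rel P ts => rel P fun i => (ts i).abstr c x
  | eq s t => eq (s.abstr c x) (t.abstr c x)
  | and φ ψ => and (φ.abstr c x) (ψ.abstr c x)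
  | or φ ψ => or (φ.abstr c x) (ψ.abstr c x)
  | imp φ ψ => imp (φ.abstr c x) (ψ.abstr c x)
  | box φ => box (φ.abstr c x)
  | dia φ => dia (φ.abstr c x)
  | all y φ => all y (φ.abstr c x)
  | ex y φ => ex y (φ.abstr c x)
  | bot => bot

/-! ### Free variables and constants under substitution -/

@[simp] theorem isSentence_and {φ ψ : Formula σ} :
    (and φ ψ).IsSentence ↔ φ.IsSentence ∧ ψ.IsSentence := Set.union_empty_iff
@[simp] theorem isSentence_or {φ ψ : Formula σ} :
    (or φ ψ).IsSentence ↔ φ.IsSentence ∧ ψ.IsSentence := Set.union_empty_iff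
@[simp] theorem isSentence_imp {φ ψ : Formula σ} :
    (imp φ ψ).IsSentence ↔ φ.IsSentence ∧ ψ.IsSentence := Set.union_empty_iff
@[simp] theorem isSentence_box {φ : Formula σ} : (box φ).IsSentence ↔ φ.IsSentence := Iff.rfl
@[simp] theorem isSentence_dia {φ : Formula σ} : (dia φ).IsSentence ↔ φ.IsSentence := Iff.rfl
@[simp] theorem isSentence_bot : (bot : Formula σ).IsSentence := rfl
@[simp] theorem isSentence_neg {φ : Formula σ} : φ.neg.IsSentence ↔ φ.IsSentence := by
  simp [neg]
@[simp] theorem isSentence_top : (top : Formula σ).IsSentence := by simp [top]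
@[simp] theorem isSentence_iff {φ ψ : Formula σ} :
    (iff φ ψ).IsSentence ↔ φ.IsSentence ∧ ψ.IsSentence := by
  simp only [iff, isSentence_and, isSentence_imp]; tauto
@[simp] theorem isSentence_all {x : ℕ} {φ : Formula σ} : (all x φ).IsSentence ↔ OnePlace x φ :=
  Set.sdiff_eq_empty
@[simp] theorem isSentence_ex {x : ℕ} {φ : Formula σ} : (ex x φ).IsSentence ↔ OnePlace x φ :=
  Set.sdiff_eq_empty

theorem IsSentence.onePlace {φ : Formula σ} (h : φ.IsSentence) (x : ℕ) : OnePlace x φ := by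
  unfold OnePlace; rw [show φ.freeVars = ∅ from h]; exact Set.empty_subset _

theorem OnePlace.imp {x : ℕ} {φ ψ : Formula σ} (h : OnePlace x φ) (h' : OnePlace x ψ) :
    OnePlace x (imp φ ψ) := Set.union_subset h h'

theorem consts_finite (φ : Formula σ) : φ.consts.Finite := by
  induction φ with
  | rel P ts => exact Set.finite_iUnion fun i => (ts i).consts_finite
  | eq s t => exact s.consts_finite.union t.consts_finite
  | and φ ψ h h' => exact h.union h'
  | or φ ψ h h' => exact h.union h'
  | imp φ ψ h h' => exact h.union h'
  | box φ h => exact h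
  | dia φ h => exact h
  | all x φ h => exact h
  | ex x φ h => exact h
  | bot => exact Set.finite_empty

theorem inst_of_notMem {x : ℕ} (c : σ.Const) {φ : Formula σ} (h : x ∉ φ.freeVars) :
    φ.inst x c = φ := by
  induction φ with
  | rel P ts =>
    simp only [freeVars, Set.mem_iUnion, not_exists] at h
    simp only [inst, fun i => Term.inst_of_notMem c (h i)]
  | eq s t =>
    simp only [freeVars, Set.mem_union, not_or] at h
    simp only [inst, Term.inst_of_notMem c h.1, Term.inst_of_notMem c h.2]
  | and φ ψ h₁ h₂ | or φ ψ h₁ h₂ | imp φ ψ h₁ h₂ =>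
    simp only [freeVars, Set.mem_union, not_or] at h
    simp only [inst, h₁ h.1, h₂ h.2]
  | box φ h₁ | dia φ h₁ => simp only [inst, h₁ h]
  | all y φ h₁ | ex y φ h₁ =>
    by_cases hy : y = x
    · simp [inst, hy]
    · have : x ∉ φ.freeVars := fun hx => h ⟨hx, fun hh => hy (Eq.symm hh)⟩
      simp [inst, hy, h₁ this]
  | bot => rfl

theorem IsSentence.inst {φ : Formula σ} (h : φ.IsSentence) (x : ℕ) (c : σ.Const) :
    φ.inst x c = φ :=
  inst_of_notMem c (by rw [show φ.freeVars = ∅ from h]; exact Set.notMem_empty x)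

theorem freeVars_inst (x : ℕ) (c : σ.Const) (φ : Formula σ) :
    (φ.inst x c).freeVars = φ.freeVars \ {x} := by
  induction φ with
  | rel P ts => simp only [inst, freeVars, Term.vars_inst, Set.iUnion_sdiff]
  | eq s t => simp only [inst, freeVars, Term.vars_inst, Set.union_sdiff_distrib]
  | and φ ψ h₁ h₂ | or φ ψ h₁ h₂ | imp φ ψ h₁ h₂ =>
    simp only [inst, freeVars, h₁, h₂, Set.union_sdiff_distrib]
  | box φ h₁ | dia φ h₁ => simp only [inst, freeVars, h₁]
  | all y φ h₁ | ex y φ h₁ =>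
    by_cases hy : y = x
    · simp [inst, hy, freeVars]
    · simp only [inst, hy, if_false, freeVars, h₁]
      exact Set.sdiff_sdiff_comm
  | bot => simp [inst, freeVars]

theorem OnePlace.isSentence_inst {x : ℕ} {φ : Formula σ} (h : OnePlace x φ) (c : σ.Const) :
    (φ.inst x c).IsSentence := by
  unfold IsSentence; rw [freeVars_inst]; exact Set.sdiff_eq_empty.2 h

theorem consts_inst_subset (x : ℕ) (c : σ.Const) (φ : Formula σ) :
    (φ.inst x c).consts ⊆ insert c φ.consts := by
  induction φ with
  | rel P ts =>
    refine Set.iUnion_subset fun i => ((ts i).consts_inst_subset x c).trans ?_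
    exact Set.insert_subset_insert (Set.subset_iUnion (fun i => (ts i).consts) i)
  | eq s t =>
    exact Set.union_subset
      ((s.consts_inst_subset x c).trans (Set.insert_subset_insert (by simp [consts])))
      ((t.consts_inst_subset x c).trans (Set.insert_subset_insert (by simp [consts])))
  | and φ ψ h₁ h₂ | or φ ψ h₁ h₂ | imp φ ψ h₁ h₂ =>
    exact Set.union_subset (h₁.trans (Set.insert_subset_insert (by simp [consts])))
      (h₂.trans (Set.insert_subset_insert (by simp [consts])))
  | box φ h₁ | dia φ h₁ => exact h₁
  | all y φ h₁ | ex y φ h₁ =>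
    by_cases hy : y = x
    · simp [inst, hy, consts]
    · simpa [inst, hy, consts] using h₁
  | bot => simp [inst, consts]

theorem consts_subset_inst (x : ℕ) (c : σ.Const) (φ : Formula σ) :
    φ.consts ⊆ (φ.inst x c).consts := by
  induction φ with
  | rel P ts => exact Set.iUnion_mono fun i => (ts i).consts_subset_inst x c
  | eq s t => exact Set.union_subset_union (s.consts_subset_inst x c) (t.consts_subset_inst x c)
  | and φ ψ h₁ h₂ | or φ ψ h₁ h₂ | imp φ ψ h₁ h₂ => exact Set.union_subset_union h₁ h₂
  | box φ h₁ | dia φ h₁ => exact h₁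
  | all y φ h₁ | ex y φ h₁ =>
    by_cases hy : y = x
    · simp [inst, hy]
    · simpa [inst, hy, consts] using h₁
  | bot => simp [inst]

theorem freeVars_close (f : σ.Const → σ.Const) (e : ℕ → Option σ.Const) (φ : Formula σ) :
    (φ.close f e).freeVars = φ.freeVars ∩ {x | e x = none} := by
  induction φ generalizing e with
  | rel P ts => simp only [close, freeVars, Term.vars_close, Set.iUnion_inter]
  | eq s t => simp only [close, freeVars, Term.vars_close, Set.union_inter_distrib_right]
  | and φ ψ h₁ h₂ | or φ ψ h₁ h₂ | imp φ ψ h₁ h₂ =>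
    simp only [close, freeVars, h₁, h₂, Set.union_inter_distrib_right]
  | box φ h₁ | dia φ h₁ => simp only [close, freeVars, h₁]
  | all y φ h₁ | ex y φ h₁ =>
    ext z
    by_cases hz : z = y
    · simp [close, freeVars, hz]
    · simp [close, freeVars, h₁, hz, Function.update_of_ne]
  | bot => simp [close, freeVars]

theorem isSentence_rename {f : σ.Const → σ.Const} {φ : Formula σ} :
    (φ.rename f).IsSentence ↔ φ.IsSentence := by
  unfold IsSentence; rw [freeVars_close]; simp

theorem OnePlace.rename {x : ℕ} {φ : Formula σ} (h : OnePlace x φ) (f : σ.Const → σ.Const) :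
    OnePlace x (φ.rename f) := by
  unfold OnePlace; rw [freeVars_close]; exact Set.inter_subset_left.trans h

theorem consts_close_subset {f : σ.Const → σ.Const} {e : ℕ → Option σ.Const} {C : Set σ.Const}
    (hf : ∀ c, f c ∈ C) (he : ∀ x, ∀ c ∈ e x, c ∈ C) (φ : Formula σ) :
    (φ.close f e).consts ⊆ C := by
  induction φ generalizing e with
  | rel P ts => exact Set.iUnion_subset fun i => Term.consts_close_subset hf he _
  | eq s t =>
    exact Set.union_subset (Term.consts_close_subset hf he _) (Term.consts_close_subset hf he _)
  | and φ ψ h₁ h₂ | or φ ψ h₁ h₂ | imp φ ψ h₁ h₂ => exact Set.union_subset (h₁ he) (h₂ he)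
  | box φ h₁ | dia φ h₁ => exact h₁ he
  | all y φ h₁ | ex y φ h₁ =>
    refine h₁ fun x c hc => ?_
    by_cases hx : x = y
    · simp [hx] at hc
    · exact he x c (by simpa [hx, Function.update_of_ne] using hc)
  | bot => simp [close, consts]

theorem close_congr {f f' : σ.Const → σ.Const} {e e' : ℕ → Option σ.Const} {φ : Formula σ}
    (hf : ∀ c ∈ φ.consts, f c = f' c) (he : ∀ x ∈ φ.freeVars, e x = e' x) :
    φ.close f e = φ.close f' e' := by
  induction φ generalizing e e' with
  | rel P ts =>
    simp only [close, rel.injEq, heq_eq_eq, true_and]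
    funext i
    exact Term.close_congr (fun c hc => hf c (Set.mem_iUnion.2 ⟨i, hc⟩))
      fun x hx => he x (Set.mem_iUnion.2 ⟨i, hx⟩)
  | eq s t =>
    simp only [close]
    rw [Term.close_congr (fun c hc => hf c (Or.inl hc)) fun x hx => he x (Or.inl hx),
      Term.close_congr (t := t) (fun c hc => hf c (Or.inr hc)) fun x hx => he x (Or.inr hx)]
  | and φ ψ h₁ h₂ | or φ ψ h₁ h₂ | imp φ ψ h₁ h₂ =>
    simp only [close]
    rw [h₁ (fun c hc => hf c (Or.inl hc)) fun x hx => he x (Or.inl hx),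
      h₂ (fun c hc => hf c (Or.inr hc)) fun x hx => he x (Or.inr hx)]
  | box φ h₁ | dia φ h₁ => simp only [close]; rw [h₁ hf he]
  | all y φ h₁ | ex y φ h₁ =>
    simp only [close]
    rw [h₁ hf]
    intro x hx
    by_cases hxy : x = y
    · simp [hxy]
    · simpa [hxy, Function.update_of_ne] using he x ⟨hx, hxy⟩
  | bot => rfl

theorem rename_id (φ : Formula σ) : φ.rename id = φ := by
  induction φ with
  | rel P ts => simp [close, Term.close_id]
  | eq s t => simp [close, Term.close_id]
  | and φ ψ h₁ h₂ | or φ ψ h₁ h₂ | imp φ ψ h₁ h₂ => simp only [rename, close] at *; rw [h₁, h₂]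
  | box φ h₁ | dia φ h₁ => simp only [rename, close] at *; rw [h₁]
  | all y φ h₁ | ex y φ h₁ =>
    simp only [rename, close] at *; rw [Function.update_eq_self y fun _ => none, h₁]
  | bot => rfl

theorem rename_rename (f g : σ.Const → σ.Const) (φ : Formula σ) :
    (φ.rename f).rename g = φ.rename (g ∘ f) := by
  induction φ with
  | rel P ts => simp [close, Term.close_close]
  | eq s t => simp [close, Term.close_close]
  | and φ ψ h₁ h₂ | or φ ψ h₁ h₂ | imp φ ψ h₁ h₂ => simp only [rename, close] at *; rw [h₁, h₂]
  | box φ h₁ | dia φ h₁ => simp only [rename, close] at *; rw [h₁]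
  | all y φ h₁ | ex y φ h₁ =>
    simp only [rename, close] at *; rw [Function.update_eq_self y fun _ => none, h₁]
  | bot => rfl

theorem inst_close (f : σ.Const → σ.Const) (e : ℕ → Option σ.Const) (x : ℕ) (c : σ.Const)
    (φ : Formula σ) (he : e x = none) :
    (φ.close f e).inst x c = φ.close f (Function.update e x (some c)) := by
  induction φ generalizing e with
  | rel P ts => simp only [close, inst, Term.inst_close f e x c _ he]
  | eq s t => simp only [close, inst, Term.inst_close f e x c _ he]
  | and φ ψ h₁ h₂ | or φ ψ h₁ h₂ | imp φ ψ h₁ h₂ => simp only [close, inst, h₁ e he, h₂ e he]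
  | box φ h₁ | dia φ h₁ => simp only [close, inst, h₁ e he]
  | all y φ h₁ | ex y φ h₁ =>
    by_cases hy : y = x
    · subst hy; simp [close, inst]
    · simp only [close, inst, hy, if_false]
      rw [h₁ _ (by simpa [Function.update_of_ne (Ne.symm hy)] using he),
        Function.update_comm (Ne.symm hy)]
  | bot => rfl

theorem rename_inst (f : σ.Const → σ.Const) (x : ℕ) (c : σ.Const) (φ : Formula σ) :
    (φ.inst x c).rename f = (φ.rename f).inst x (f c) := by
  induction φ with
  | rel P ts => simp only [close, inst, Term.close_inst]
  | eq s t => simp only [close, inst, Term.close_inst]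
  | and φ ψ h₁ h₂ | or φ ψ h₁ h₂ | imp φ ψ h₁ h₂ =>
    simp only [rename, close, inst] at *; rw [h₁, h₂]
  | box φ h₁ | dia φ h₁ => simp only [rename, close, inst] at *; rw [h₁]
  | all y φ h₁ | ex y φ h₁ =>
    by_cases hy : y = x
    · simp only [close, inst, hy, if_true]
    · simp only [rename, close, inst, hy, if_false] at *
      rw [Function.update_eq_self y fun _ => none, h₁]
  | bot => rfl

theorem modalFree_rename {f : σ.Const → σ.Const} {e : ℕ → Option σ.Const} {φ : Formula σ}
    (h : φ.ModalFree) : (φ.close f e).ModalFree := by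
  induction φ generalizing e with
  | rel P ts | eq s t | bot => trivial
  | and φ ψ h₁ h₂ | or φ ψ h₁ h₂ | imp φ ψ h₁ h₂ => exact ⟨h₁ h.1, h₂ h.2⟩
  | box φ h₁ | dia φ h₁ => exact h.elim
  | all y φ h₁ | ex y φ h₁ => exact h₁ h

theorem consts_abstr (c : σ.Const) (x : ℕ) (φ : Formula σ) :
    (φ.abstr c x).consts = φ.consts \ {c} := by
  induction φ with
  | rel P ts => simp only [abstr, consts, Term.consts_abstr, Set.iUnion_sdiff]
  | eq s t => simp only [abstr, consts, Term.consts_abstr, Set.union_sdiff_distrib]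
  | and φ ψ h₁ h₂ | or φ ψ h₁ h₂ | imp φ ψ h₁ h₂ =>
    simp only [abstr, consts, h₁, h₂, Set.union_sdiff_distrib]
  | box φ h₁ | dia φ h₁ | all y φ h₁ | ex y φ h₁ => simp only [abstr, consts, h₁]
  | bot => simp [abstr, consts]

theorem freeVars_abstr_subset (c : σ.Const) (x : ℕ) (φ : Formula σ) :
    (φ.abstr c x).freeVars ⊆ insert x φ.freeVars := by
  induction φ with
  | rel P ts =>
    refine Set.iUnion_subset fun i => ((ts i).vars_abstr_subset c x).trans ?_
    exact Set.insert_subset_insert (Set.subset_iUnion (fun i => (ts i).vars) i)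
  | eq s t =>
    exact Set.union_subset
      ((s.vars_abstr_subset c x).trans (Set.insert_subset_insert (by simp [freeVars])))
      ((t.vars_abstr_subset c x).trans (Set.insert_subset_insert (by simp [freeVars])))
  | and φ ψ h₁ h₂ | or φ ψ h₁ h₂ | imp φ ψ h₁ h₂ =>
    exact Set.union_subset (h₁.trans (Set.insert_subset_insert (by simp [freeVars])))
      (h₂.trans (Set.insert_subset_insert (by simp [freeVars])))
  | box φ h₁ | dia φ h₁ => exact h₁
  | all y φ h₁ | ex y φ h₁ =>
    rintro z ⟨hz, hzy⟩
    rcases h₁ hz with h | h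
    · exact Or.inl h
    · exact Or.inr ⟨h, hzy⟩
  | bot => simp [abstr, freeVars]

/-- A variable beyond all those of φ, bound ones included, is neither captured nor confused with a
free one. Asking for all large `x` lets the bounds of subformulas be combined by a maximum. -/
theorem exists_inst_abstr (c : σ.Const) (φ : Formula σ) :
    ∃ n, ∀ x, n ≤ x → (φ.abstr c x).inst x c = φ := by
  induction φ with
  | rel P ts =>
    choose n hn using fun i => (ts i).exists_vars_bound
    refine ⟨Finset.univ.sup n, fun x hx => ?_⟩
    simp only [abstr, inst, rel.injEq, heq_eq_eq, true_and]
    funext i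
    exact Term.inst_abstr (hn i x ((Finset.le_sup (Finset.mem_univ i)).trans hx))
  | eq s t =>
    obtain ⟨n, hn⟩ := s.exists_vars_bound
    obtain ⟨m, hm⟩ := t.exists_vars_bound
    refine ⟨max n m, fun x hx => ?_⟩
    simp only [abstr, inst, Term.inst_abstr (hn x ((le_max_left _ _).trans hx)),
      Term.inst_abstr (hm x ((le_max_right _ _).trans hx))]
  | and φ ψ h₁ h₂ | or φ ψ h₁ h₂ | imp φ ψ h₁ h₂ =>
    obtain ⟨n, hn⟩ := h₁
    obtain ⟨m, hm⟩ := h₂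
    refine ⟨max n m, fun x hx => ?_⟩
    simp only [abstr, inst, hn x ((le_max_left _ _).trans hx), hm x ((le_max_right _ _).trans hx)]
  | box φ h₁ | dia φ h₁ =>
    obtain ⟨n, hn⟩ := h₁
    exact ⟨n, fun x hx => by simp only [abstr, inst, hn x hx]⟩
  | all y φ h₁ | ex y φ h₁ =>
    obtain ⟨n, hn⟩ := h₁
    refine ⟨max n (y + 1), fun x hx => ?_⟩
    have : y ≠ x := by have := (le_max_right _ _).trans hx; omega
    simp only [abstr, inst, this, if_false, hn x ((le_max_left _ _).trans hx)]
  | bot => exact ⟨0, fun _ _ => rfl⟩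

/-- Every sentence is of the form `φ(c)`, with `c` not occurring in `φ(x)`. -/
theorem IsSentence.exists_eq_inst {χ : Formula σ} (h : χ.IsSentence) (c : σ.Const) :
    ∃ x φ, OnePlace x φ ∧ φ.inst x c = χ ∧ φ.consts = χ.consts \ {c} := by
  obtain ⟨n, hn⟩ := exists_inst_abstr c χ
  refine ⟨n, χ.abstr c n, ?_, hn n le_rfl, consts_abstr c n χ⟩
  have := freeVars_abstr_subset c n χ
  rwa [show χ.freeVars = ∅ from h, insert_empty_eq] at this

theorem isSentence_conj {l : List (Formula σ)} (h : ∀ φ ∈ l, φ.IsSentence) :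
    (conj l).IsSentence := by
  induction l with
  | nil => exact isSentence_top
  | cons a l ih => simp_all [conj]

theorem consts_conj {l : List (Formula σ)} {c : σ.Const} (h : ∀ φ ∈ l, c ∉ φ.consts) :
    c ∉ (conj l).consts := by
  induction l with
  | nil => simp [conj, top, neg, consts]
  | cons a l ih => simp_all [conj, consts]

theorem rename_conj (f : σ.Const → σ.Const) (l : List (Formula σ)) :
    (conj l).rename f = conj (l.map (rename f)) := by
  induction l with
  | nil => rfl
  | cons a l ih => simp only [conj, List.map_cons, rename, close] at *; rw [ih]

/-! ### Countability -/

/-- A numerical code of a formula, relative to codes of predicates and terms. -/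
def code (p : σ.Pred → ℕ) (t : Term σ → ℕ) : Formula σ → ℕ
  | rel P ts => Nat.pair 0 (Nat.pair (p P) (Encodable.encode (List.ofFn fun i => t (ts i))))
  | eq s s' => Nat.pair 1 (Nat.pair (t s) (t s'))
  | and φ ψ => Nat.pair 2 (Nat.pair (φ.code p t) (ψ.code p t))
  | or φ ψ => Nat.pair 3 (Nat.pair (φ.code p t) (ψ.code p t))
  | imp φ ψ => Nat.pair 4 (Nat.pair (φ.code p t) (ψ.code p t))
  | box φ => Nat.pair 5 (φ.code p t)
  | dia φ => Nat.pair 6 (φ.code p t)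
  | all x φ => Nat.pair 7 (Nat.pair x (φ.code p t))
  | ex x φ => Nat.pair 8 (Nat.pair x (φ.code p t))
  | bot => Nat.pair 9 0

theorem code_injective {p : σ.Pred → ℕ} {t : Term σ → ℕ} (hp : Function.Injective p)
    (ht : Function.Injective t) : Function.Injective (code p t) := by
  intro φ
  induction φ with
  | rel P ts =>
    intro ψ h
    cases ψ with
    | rel Q us =>
      simp only [code, Nat.pair_eq_pair, true_and] at h
      obtain ⟨h₁, h₂⟩ := h
      obtain rfl := hp h₁
      have := List.ofFn_injective (Encodable.encode_injective h₂)
      congr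
      funext i
      exact ht (congrFun this i)
    | _ => simp [code, Nat.pair_eq_pair] at h
  | eq s s' =>
    intro ψ h
    cases ψ with
    | eq u u' =>
      simp only [code, Nat.pair_eq_pair, true_and] at h
      rw [ht h.1, ht h.2]
    | _ => simp [code, Nat.pair_eq_pair] at h
  | bot => intro ψ h; cases ψ <;> simp [code, Nat.pair_eq_pair] at h ⊢
  | and φ φ' h₁ h₂ | or φ φ' h₁ h₂ | imp φ φ' h₁ h₂ =>
    intro ψ h
    cases ψ <;> simp only [code, Nat.pair_eq_pair] at h <;> first
      | (exact absurd h.1 (by decide))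
      | (rw [h₁ h.2.1, h₂ h.2.2])
  | box φ h₁ | dia φ h₁ =>
    intro ψ h
    cases ψ <;> simp only [code, Nat.pair_eq_pair] at h <;> first
      | (exact absurd h.1 (by decide))
      | (rw [h₁ h.2])
  | all x φ h₁ | ex x φ h₁ =>
    intro ψ h
    cases ψ <;> simp only [code, Nat.pair_eq_pair] at h <;> first
      | (exact absurd h.1 (by decide))
      | (rw [h.2.1, h₁ h.2.2])

/-- Allows the Lindenbaum construction to decide sentences one at a time, with only finitely many
added at each step. -/
instance : Countable (Formula σ) := by
  have := σ.pred_countable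
  have := σ.const_countable
  have : Countable (Term σ) := by
    have : Function.Injective (fun t : Term σ => (match t with
        | .var x => Sum.inl x
        | .const c => Sum.inr c : ℕ ⊕ σ.Const)) := by
      intro s t h
      cases s <;> cases t <;> simp_all
    exact this.countable
  obtain ⟨p, hp⟩ := exists_injective_nat σ.Pred
  obtain ⟨t, ht⟩ := exists_injective_nat (Term σ)
  exact (code_injective hp ht).countable

end Formula

open Formula

/-! ### Renaming constants in proofs -/

theorem PropFormula.subst_rename (f : σ.Const → σ.Const) (s : ℕ → Formula σ) (a : PropFormula) :
    (a.subst s).rename f = a.subst fun n => (s n).rename f := by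
  induction a with
  | atom n => rfl
  | bot => rfl
  | and a b h₁ h₂ | or a b h₁ h₂ | imp a b h₁ h₂ =>
    simp only [PropFormula.subst, rename, Formula.close] at *; rw [h₁, h₂]

theorem PropFormula.isSentence_subst {s : ℕ → Formula σ} (hs : ∀ n, (s n).IsSentence)
    (a : PropFormula) : (a.subst s).IsSentence := by
  induction a with
  | atom n => exact hs n
  | bot => rfl
  | and a b h₁ h₂ | or a b h₁ h₂ | imp a b h₁ h₂ => simp [PropFormula.subst, h₁, h₂]

theorem rename_all (f : σ.Const → σ.Const) (x : ℕ) (φ : Formula σ) :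
    (all x φ).rename f = all x (φ.rename f) := by
  simp only [rename, close]; rw [Function.update_eq_self x fun _ => none]

theorem rename_ex (f : σ.Const → σ.Const) (x : ℕ) (φ : Formula σ) :
    (ex x φ).rename f = ex x (φ.rename f) := by
  simp only [rename, close]; rw [Function.update_eq_self x fun _ => none]

theorem rename_imp (f : σ.Const → σ.Const) (φ ψ : Formula σ) :
    (imp φ ψ).rename f = imp (φ.rename f) (ψ.rename f) := rfl

/-- Provability is preserved by arbitrary maps of the constants. -/
theorem Provable.rename {A : Set (Formula σ)}
    (hA : ∀ f, ∀ φ ∈ A, φ.rename f ∈ A) {φ : Formula σ} (h : Provable A φ)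
    (f : σ.Const → σ.Const) : Provable A (φ.rename f) := by
  induction h generalizing f with
  | extra h => exact .extra (hA f _ h)
  | int h hs =>
    rw [PropFormula.subst_rename]
    exact .int h fun n => isSentence_rename.2 (hs n)
  | boxAnd h₁ h₂ => exact .boxAnd (isSentence_rename.2 h₁) (isSentence_rename.2 h₂)
  | boxTop => exact .boxTop
  | diaOr h₁ h₂ => exact .diaOr (isSentence_rename.2 h₁) (isSentence_rename.2 h₂)
  | diaBot => exact .diaBot
  | fs1 h₁ h₂ => exact .fs1 (isSentence_rename.2 h₁) (isSentence_rename.2 h₂)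
  | fs2 h₁ h₂ => exact .fs2 (isSentence_rename.2 h₁) (isSentence_rename.2 h₂)
  | univ c h =>
    rw [rename_imp, rename_all, rename_inst]; exact .univ _ (h.rename f)
  | exist c h =>
    rw [rename_imp, rename_ex, rename_inst]; exact .exist _ (h.rename f)
  | allAnt h h' =>
    rw [rename_imp, rename_imp, rename_ex, rename_all]
    exact .allAnt (h.rename f) (isSentence_rename.2 h')
  | allCon h h' =>
    rw [rename_imp, rename_imp, rename_all, rename_all]
    exact .allCon (isSentence_rename.2 h) (h'.rename f)
  | idRef c => exact .idRef _
  | idSub c₁ c₂ h h' =>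
    rw [rename_imp, rename_imp, rename_inst, rename_inst]
    exact .idSub _ _ (h.rename f) (modalFree_rename h')
  | mp _ _ h₁ h₂ => exact .mp (h₁ f) (h₂ f)
  | @gen x φ c h hc _ ih =>
    classical
    have := σ.const_infinite
    -- `f` need not be injective and may send `c` to a constant of the renamed formula. The
    -- eigenconstant is redirected to a fresh `d`, which is why the induction is over all `f`.
    obtain ⟨d, hd⟩ := (φ.rename f).consts_finite.exists_notMem
    have key := ih (Function.update f c d)
    have hφ : φ.rename (Function.update f c d) = φ.rename f :=
      close_congr (fun a ha => Function.update_of_ne (by rintro rfl; exact hc ha) _ _) fun _ _ => rfl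
    rw [rename_inst, hφ, Function.update_self] at key
    rw [rename_all]
    exact .gen (h.rename f) hd key
  | regBox _ ih => exact .regBox (ih f)
  | regDia _ ih => exact .regDia (ih f)

theorem Provable.isSentence {A : Set (Formula σ)} (hA : ∀ φ ∈ A, φ.IsSentence)
    {φ : Formula σ} (h : Provable A φ) : φ.IsSentence := by
  induction h with
  | extra h => exact hA _ h
  | int h hs => exact PropFormula.isSentence_subst hs _
  | univ c h | exist c h => simp [h, h.isSentence_inst]
  | allAnt h h' => simp [h, h', h.imp (h'.onePlace _)]
  | allCon h h' => simp [h, h', (h.onePlace _).imp h']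
  | idRef c => simp [IsSentence, freeVars, Term.vars]
  | idSub c₁ c₂ h h' =>
    simp only [isSentence_imp, h.isSentence_inst, and_self, and_true]
    simp [IsSentence, freeVars, Term.vars]
  | gen h => simpa using h
  | _ => simp_all

/-! ### Derivability from a set of sentences -/

/-- Derivability in FOFS-D from those members of `T` that are sentences. -/
inductive Der (T : Set (Formula σ)) : Formula σ → Prop
  | ax {φ} : φ ∈ T → φ.IsSentence → Der T φ
  | thm {φ} : Provable (axiomD σ) φ → Der T φ
  | mp {φ ψ} : Der T (imp φ ψ) → Der T φ → Der T ψ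

theorem axiomD_isSentence : ∀ φ ∈ axiomD σ, φ.IsSentence := by
  rintro _ ⟨φ, h, rfl⟩; simp [h]

theorem axiomD_rename (f : σ.Const → σ.Const) : ∀ φ ∈ axiomD σ, φ.rename f ∈ axiomD σ := by
  rintro _ ⟨φ, h, rfl⟩; exact ⟨φ.rename f, isSentence_rename.2 h, rfl⟩

/-- The substitution of three formulas for the propositional atoms. -/
def atoms (a b c : Formula σ) : ℕ → Formula σ
  | 0 => a
  | 1 => b
  | _ => c

theorem isSentence_atoms {a b c : Formula σ} (ha : a.IsSentence) (hb : b.IsSentence)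
    (hc : c.IsSentence) (n : ℕ) : (atoms a b c n).IsSentence := by
  rcases n with _ | _ | n
  exacts [ha, hb, hc]

namespace Der

variable {S T : Set (Formula σ)} {a b c φ ψ χ : Formula σ}

theorem isSentence (h : Der T φ) : φ.IsSentence := by
  induction h with
  | ax _ h => exact h
  | thm h => exact h.isSentence axiomD_isSentence
  | mp _ _ h _ => exact (isSentence_imp.1 h).2

theorem provable (h : Der ∅ φ) : Provable (axiomD σ) φ := by
  induction h with
  | ax h => exact h.elim
  | thm h => exact h
  | mp _ _ h₁ h₂ => exact .mp h₁ h₂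

theorem mono (hST : S ⊆ T) (h : Der S φ) : Der T φ := by
  induction h with
  | ax h h' => exact .ax (hST h) h'
  | thm h => exact .thm h
  | mp _ _ h₁ h₂ => exact .mp h₁ h₂

theorem of_empty (h : Der ∅ φ) : Der T φ := h.mono (Set.empty_subset T)

theorem cut (hST : ∀ ψ ∈ S, Der T ψ) (h : Der S φ) : Der T φ := by
  induction h with
  | ax h _ => exact hST _ h
  | thm h => exact .thm h
  | mp _ _ h₁ h₂ => exact .mp h₁ h₂

theorem int (p : PropFormula) (hp : IPC p) (ha : a.IsSentence) (hb : b.IsSentence)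
    (hc : c.IsSentence) : Der T (p.subst (atoms a b c)) :=
  .thm (.int hp (isSentence_atoms ha hb hc))

open PropFormula in
theorem k (ha : a.IsSentence) (hb : b.IsSentence) : Der T (.imp a (.imp b a)) :=
  int _ (.k (atom 0) (atom 1)) ha hb hb

open PropFormula in
theorem s (ha : a.IsSentence) (hb : b.IsSentence) (hc : c.IsSentence) :
    Der T (.imp (.imp a (.imp b c)) (.imp (.imp a b) (.imp a c))) :=
  int _ (.s (atom 0) (atom 1) (atom 2)) ha hb hc

theorem refl (ha : a.IsSentence) : Der T (.imp a a) :=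
  ((s ha (b := .imp a a) (by simp [ha]) ha).mp (k ha (by simp [ha]))).mp (k ha ha)

theorem k' (ha : a.IsSentence) (h : Der T b) : Der T (.imp a b) := (k h.isSentence ha).mp h

/-- The deduction theorem. -/
theorem intro (hφ : φ.IsSentence) (h : Der (insert φ T) ψ) : Der T (.imp φ ψ) := by
  induction h with
  | ax h h' =>
    rcases h with rfl | h
    · exact refl hφ
    · exact k' hφ (.ax h h')
  | thm h => exact k' hφ (.thm h)
  | @mp a b _ _ h₁ h₂ =>
    have := h₁.isSentence
    simp only [isSentence_imp] at this
    exact ((s hφ this.2.1 this.2.2).mp h₁).mp h₂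

theorem elim (h : Der T (.imp φ ψ)) : Der (insert φ T) ψ :=
  (h.mono (Set.subset_insert _ _)).mp (.ax (Set.mem_insert _ _) (isSentence_imp.1 h.isSentence).1)

theorem hyp (h : φ.IsSentence) : Der (insert φ T) φ := .ax (Set.mem_insert _ _) h

theorem weak (h : Der T ψ) : Der (insert φ T) ψ := h.mono (Set.subset_insert _ _)

theorem trans (h : Der T (.imp a b)) (h' : Der T (.imp b c)) : Der T (.imp a c) :=
  intro (isSentence_imp.1 h.isSentence).1 (h'.weak.mp h.elim)

open PropFormula in
theorem andLeft (h : Der T (.and a b)) : Der T a :=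
  have h' := isSentence_and.1 h.isSentence
  (int _ (.andLeft (atom 0) (atom 1)) h'.1 h'.2 h'.2).mp h

open PropFormula in
theorem andRight (h : Der T (.and a b)) : Der T b :=
  have h' := isSentence_and.1 h.isSentence
  (int _ (.andRight (atom 0) (atom 1)) h'.1 h'.2 h'.2).mp h

open PropFormula in
theorem andIntro (h : Der T a) (h' : Der T b) : Der T (.and a b) :=
  ((int _ (.andIntro (atom 0) (atom 1)) h.isSentence h'.isSentence h'.isSentence).mp h).mp h'

open PropFormula in
theorem orLeft (h : Der T a) (hb : b.IsSentence) : Der T (.or a b) :=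
  (int _ (.orLeft (atom 0) (atom 1)) h.isSentence hb hb).mp h

open PropFormula in
theorem orRight (ha : a.IsSentence) (h : Der T b) : Der T (.or a b) :=
  (int _ (.orRight (atom 0) (atom 1)) ha h.isSentence h.isSentence).mp h

open PropFormula in
theorem orElim (h : Der T (.imp a c)) (h' : Der T (.imp b c)) : Der T (.imp (.or a b) c) :=
  have h₁ := isSentence_imp.1 h.isSentence
  have h₂ := isSentence_imp.1 h'.isSentence
  ((int _ (.orElim (atom 0) (atom 1) (atom 2)) h₁.1 h₂.1 h₁.2).mp h).mp h'

open PropFormula in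
theorem botElim (h : Der T .bot) (ha : a.IsSentence) : Der T a :=
  (int _ (.botElim (atom 0)) ha ha ha).mp h

theorem top : Der T .top := refl isSentence_bot

theorem conj {l : List (Formula σ)} (h : ∀ φ ∈ l, Der T φ) : Der T (conj l) := by
  induction l with
  | nil => exact top
  | cons a l ih =>
    exact andIntro (h a List.mem_cons_self) (ih fun φ hφ => h φ (List.mem_cons_of_mem _ hφ))

theorem of_conj {l : List (Formula σ)} (h : Der T (Formula.conj l)) : ∀ φ ∈ l, Der T φ := by
  induction l with
  | nil => simp
  | cons a l ih =>
    intro φ hφ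
    rcases List.mem_cons.1 hφ with rfl | hφ
    · exact h.andLeft
    · exact ih h.andRight φ hφ

/-- Derivations use finitely many premises. -/
theorem exists_list (h : Der T φ) :
    ∃ l : List (Formula σ), (∀ γ ∈ l, γ ∈ T ∧ γ.IsSentence) ∧ Der {γ | γ ∈ l} φ := by
  induction h with
  | @ax φ h h' => exact ⟨[φ], by simp [h, h'], .ax (by simp) h'⟩
  | thm h => exact ⟨[], by simp, .thm h⟩
  | mp _ _ h₁ h₂ =>
    obtain ⟨l, hl, h⟩ := h₁
    obtain ⟨l', hl', h'⟩ := h₂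
    refine ⟨l ++ l', fun γ hγ => ?_, .mp (h.mono ?_) (h'.mono ?_)⟩
    · rcases List.mem_append.1 hγ with h | h
      exacts [hl γ h, hl' γ h]
    · exact fun γ hγ => List.mem_append.2 (Or.inl hγ)
    · exact fun γ hγ => List.mem_append.2 (Or.inr hγ)

theorem exists_conj (h : Der T φ) : ∃ l : List (Formula σ), (∀ γ ∈ l, γ ∈ T ∧ γ.IsSentence) ∧
    Provable (axiomD σ) (.imp (Formula.conj l) φ) := by
  obtain ⟨l, hl, h⟩ := h.exists_list
  have hs := isSentence_conj fun γ hγ => (hl γ hγ).2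
  exact ⟨l, hl, provable (intro hs (cut (fun γ hγ => of_conj (hyp hs) γ hγ) h))⟩

/-- Premises from a set closed under conjunction can be merged into one. -/
theorem exists_of_union {X Y : Set (Formula σ)} (hY : ∀ y ∈ Y, y.IsSentence) (htop : .top ∈ Y)
    (hand : ∀ y ∈ Y, ∀ z ∈ Y, .and y z ∈ Y) (h : Der (X ∪ Y) φ) : ∃ y ∈ Y, Der X (.imp y φ) := by
  induction h with
  | @ax φ h h' =>
    rcases h with h | h
    · exact ⟨_, htop, k' isSentence_top (.ax h h')⟩
    · exact ⟨φ, h, refl h'⟩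
  | thm h => exact ⟨_, htop, k' isSentence_top (.thm h)⟩
  | @mp a b _ _ h₁ h₂ =>
    obtain ⟨y, hy, h⟩ := h₁
    obtain ⟨z, hz, h'⟩ := h₂
    have hs : (Formula.and y z).IsSentence := isSentence_and.2 ⟨hY y hy, hY z hz⟩
    refine ⟨_, hand y hy z hz, intro hs (.mp (φ := a) ?_ ?_)⟩
    · exact h.weak.mp (hyp hs).andLeft
    · exact h'.weak.mp (hyp hs).andRight

theorem exists_of_iUnion {F : ℕ → Set (Formula σ)} (hF : Monotone F) (h : Der (⋃ n, F n) φ) :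
    ∃ n, Der (F n) φ := by
  induction h with
  | ax h h' =>
    obtain ⟨n, hn⟩ := Set.mem_iUnion.1 h
    exact ⟨n, .ax hn h'⟩
  | thm h => exact ⟨0, .thm h⟩
  | mp _ _ h₁ h₂ =>
    obtain ⟨n, h⟩ := h₁
    obtain ⟨m, h'⟩ := h₂
    exact ⟨max n m, .mp (h.mono (hF (le_max_left n m))) (h'.mono (hF (le_max_right n m)))⟩

/-! #### Quantifiers -/

/-- The finitely many premises used form one conjunction without `d`. The rule of generalization
applies to the implication from it, and `allCon` takes the conjunction out of the quantifier. -/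
theorem gen {x : ℕ} {d : σ.Const} (hφ : OnePlace x φ) (hd : d ∉ φ.consts)
    (hT : ∀ γ ∈ T, d ∉ γ.consts) (h : Der T (φ.inst x d)) : Der T (.all x φ) := by
  obtain ⟨l, hl, h⟩ := h.exists_conj
  have hs := isSentence_conj fun γ hγ => (hl γ hγ).2
  have hd' : d ∉ (Formula.conj l).consts := consts_conj fun γ hγ => hT γ (hl γ hγ).1
  have h' : Provable (axiomD σ) (.all x (.imp (Formula.conj l) φ)) := by
    refine .gen ((hs.onePlace x).imp hφ) (by simp [consts, hd, hd']) (c := d) ?_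
    simpa only [inst, hs.inst x d] using h
  exact .mp (.mp (.thm (.allCon hs hφ)) (.thm h')) (conj fun γ hγ => .ax (hl γ hγ).1 (hl γ hγ).2)

theorem exElim {x : ℕ} {d : σ.Const} (hφ : OnePlace x φ) (hd : d ∉ φ.consts)
    (hd' : d ∉ ψ.consts) (hT : ∀ γ ∈ T, d ∉ γ.consts) (h : Der T (.imp (φ.inst x d) ψ)) :
    Der T (.imp (.ex x φ) ψ) := by
  have hψ := (isSentence_imp.1 h.isSentence).2
  refine .mp (.thm (.allAnt hφ hψ)) (gen (d := d) (hφ.imp (hψ.onePlace x)) ?_ hT ?_)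
  · simp [consts, hd, hd']
  · simpa only [inst, hψ.inst x d] using h

theorem exIntro {x : ℕ} (d : σ.Const) (hφ : OnePlace x φ) :
    Der T (.imp (φ.inst x d) (.ex x φ)) := .thm (.exist d hφ)

/-! #### Modalities -/

theorem boxMono (h : Der ∅ (.imp a b)) : Der T (.imp (.box a) (.box b)) :=
  .thm (.regBox h.provable)

theorem diaMono (h : Der ∅ (.imp a b)) : Der T (.imp (.dia a) (.dia b)) :=
  .thm (.regDia h.provable)

theorem nec (h : Der ∅ a) : Der T (.box a) :=
  (boxMono (k' isSentence_top h)).mp (.thm .boxTop)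

theorem boxAnd (h : Der T (.box a)) (h' : Der T (.box b)) : Der T (.box (.and a b)) :=
  (andRight (.thm (.boxAnd (isSentence_box.1 h.isSentence) (isSentence_box.1 h'.isSentence)))).mp
    (andIntro h h')

theorem boxMp (h : Der T (.box (.imp a b))) (h' : Der T (.box a)) : Der T (.box b) := by
  refine (boxMono (intro ?_ ?_)).mp (boxAnd h h')
  · exact isSentence_and.2 ⟨h.isSentence, h'.isSentence⟩
  · have := hyp (T := ∅) (φ := Formula.and (.imp a b) a)
      (isSentence_and.2 ⟨h.isSentence, h'.isSentence⟩)
    exact this.andLeft.mp this.andRight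

/-- Theorems are necessitated and □ distributes over each modus ponens, so a derivation can be boxed
line by line. -/
theorem box_of_boxInv (h : Der {ψ | Formula.box ψ ∈ T} φ) : Der T (.box φ) := by
  induction h with
  | ax h h' => exact .ax h h'
  | thm h => exact nec (.thm h)
  | mp _ _ h₁ h₂ => exact boxMp h₁ h₂

theorem diaMp (h : Der T (.dia (.imp a b))) (h' : Der T (.box a)) : Der T (.dia b) :=
  ((Der.thm (.fs2 (isSentence_imp.1 h.isSentence).1 (isSentence_imp.1 h.isSentence).2)).mp h).mp h'

/-- Since a implies (a → b) → b, monotonicity gives ◇((a → b) → b), and `fs2` detaches □(a → b). -/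
theorem diaBoxMp (h : Der T (.dia a)) (h' : Der T (.box (.imp a b))) : Der T (.dia b) := by
  have hs : (Formula.imp a b).IsSentence := h'.isSentence
  refine diaMp (a := .imp a b) ((diaMono (intro (isSentence_dia.1 h.isSentence) (intro hs ?_))).mp h) h'
  exact (hyp hs).mp (hyp (isSentence_dia.1 h.isSentence)).weak

end Der

theorem derives_iff_der {Γ : Set (Formula σ)} {φ : Formula σ} (hΓ : ∀ γ ∈ Γ, γ.IsSentence) :
    Derives (axiomD σ) Γ φ ↔ Der Γ φ := by
  constructor
  · rintro ⟨l, hl, h⟩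
    exact .mp (.thm h) (.conj fun γ hγ => .ax (hl γ hγ) (hΓ γ (hl γ hγ)))
  · intro h
    obtain ⟨l, hl, h⟩ := h.exists_conj
    exact ⟨l, fun γ hγ => (hl γ hγ).1, h⟩

/-! ### Saturated theories -/

/-- Sentences with constants in `C`. -/
def InLang (C : Set σ.Const) (φ : Formula σ) : Prop := φ.IsSentence ∧ φ.consts ⊆ C

section InLang

variable {C C' : Set σ.Const} {φ ψ : Formula σ}

theorem InLang.mono (h : C ⊆ C') (hφ : InLang C φ) : InLang C' φ := ⟨hφ.1, hφ.2.trans h⟩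

theorem inLang_and : InLang C (and φ ψ) ↔ InLang C φ ∧ InLang C ψ := by
  simp only [InLang, isSentence_and, consts, Set.union_subset_iff]; tauto

theorem inLang_or : InLang C (or φ ψ) ↔ InLang C φ ∧ InLang C ψ := by
  simp only [InLang, isSentence_or, consts, Set.union_subset_iff]; tauto

theorem inLang_imp : InLang C (imp φ ψ) ↔ InLang C φ ∧ InLang C ψ := by
  simp only [InLang, isSentence_imp, consts, Set.union_subset_iff]; tauto

theorem inLang_box : InLang C (box φ) ↔ InLang C φ := Iff.rfl

theorem inLang_dia : InLang C (dia φ) ↔ InLang C φ := Iff.rfl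

theorem inLang_bot : InLang C (bot : Formula σ) := ⟨rfl, Set.empty_subset _⟩

theorem inLang_top : InLang C (top : Formula σ) := inLang_imp.2 ⟨inLang_bot, inLang_bot⟩

theorem InLang.inst {x : ℕ} {c : σ.Const} (hφ : OnePlace x φ) (h : φ.consts ⊆ C) (hc : c ∈ C) :
    InLang C (φ.inst x c) :=
  ⟨hφ.isSentence_inst c, (consts_inst_subset x c φ).trans (Set.insert_subset hc h)⟩

theorem InLang.notMem {c : σ.Const} (h : InLang C φ) (hc : c ∉ C) : c ∉ φ.consts :=
  fun h' => hc (h.2 h')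

end InLang

/-- Prime theories in the language with constants `C`, with witnesses in `C`. -/
structure Saturated (C : Set σ.Const) (T : Set (Formula σ)) : Prop where
  inLang : ∀ φ ∈ T, InLang C φ
  closed : ∀ φ, InLang C φ → Der T φ → φ ∈ T
  consistent : bot ∉ T
  prime : ∀ φ ψ, Formula.or φ ψ ∈ T → φ ∈ T ∨ ψ ∈ T
  witness : ∀ x φ, ex x φ ∈ T → ∃ c ∈ C, φ.inst x c ∈ T

/-- Sets of sentences that can be omitted by a saturated theory which takes its witnesses
from `S`. -/
structure OmitSet (C S : Set σ.Const) (O : Set (Formula σ)) : Prop where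
  inLang : ∀ o ∈ O, InLang C o
  nonempty : O.Nonempty
  or : ∀ o ∈ O, ∀ o' ∈ O, Formula.or o o' ∈ O
  ex : ∀ c ∈ S, ∀ x φ, OnePlace x φ → c ∉ φ.consts → φ.inst x c ∈ O → ex x φ ∈ O

theorem OmitSet.anti {C S S' : Set σ.Const} {O : Set (Formula σ)} (h : OmitSet C S O)
    (hS : S' ⊆ S) : OmitSet C S' O :=
  ⟨h.inLang, h.nonempty, h.or, fun c hc => h.ex c (hS hc)⟩

/-- One step of a Henkin construction: θ is accepted, with a witness if it is existential, unless it
already implies a sentence to be omitted. Finiteness of `F` keeps infinitely many constants of `S`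
unused. -/
theorem exists_extension_step {C S : Set σ.Const} {A O F : Set (Formula σ)} (hSC : S ⊆ C)
    (hS : S.Infinite) (hAS : ∀ φ ∈ A, ∀ c ∈ S, c ∉ φ.consts) (hO : OmitSet C S O) (hF : F.Finite)
    (hFC : ∀ φ ∈ F, InLang C φ) (hFO : ∀ o ∈ O, ¬ Der (A ∪ F) o) (θ : Formula σ) :
    ∃ F' : Set (Formula σ), (F'.Finite ∧ (∀ φ ∈ F', InLang C φ) ∧ ∀ o ∈ O, ¬ Der (A ∪ F') o) ∧
      F ⊆ F' ∧ (InLang C θ →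
        (θ ∈ F' ∧ ∀ x ψ, θ = ex x ψ → ∃ c ∈ C, ψ.inst x c ∈ F') ∨
        ∃ o ∈ O, Der (A ∪ F) (imp θ o)) := by
  by_cases hθ : InLang C θ
  swap
  · exact ⟨F, ⟨hF, hFC, hFO⟩, subset_rfl, fun h => (hθ h).elim⟩
  by_cases hθO : ∀ o ∈ O, ¬ Der (insert θ (A ∪ F)) o
  swap
  · push Not at hθO
    obtain ⟨o, ho, h⟩ := hθO
    exact ⟨F, ⟨hF, hFC, hFO⟩, subset_rfl, fun _ => Or.inr ⟨o, ho, h.intro hθ.1⟩⟩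
  by_cases hex : ∃ x ψ, θ = ex x ψ
  swap
  · refine ⟨insert θ F, ⟨hF.insert θ, ?_, ?_⟩, Set.subset_insert θ F, fun _ =>
      Or.inl ⟨Set.mem_insert θ F, fun x ψ h => (hex ⟨x, ψ, h⟩).elim⟩⟩
    · rintro φ (rfl | h)
      exacts [hθ, hFC φ h]
    · rwa [Set.union_insert]
  obtain ⟨x, ψ, rfl⟩ := hex
  have hψ : OnePlace x ψ := isSentence_ex.1 hθ.1
  have hfin : (ψ.consts ∪ ⋃ φ ∈ F, φ.consts).Finite :=
    ψ.consts_finite.union (hF.biUnion fun φ _ => φ.consts_finite)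
  obtain ⟨c, hcS, hc⟩ := (hS.sdiff hfin).nonempty
  simp only [Set.mem_union, Set.mem_iUnion, not_or, not_exists] at hc
  refine ⟨insert (ψ.inst x c) (insert (ex x ψ) F), ⟨(hF.insert _).insert _, ?_, ?_⟩, ?_, fun _ =>
    Or.inl ⟨by simp, ?_⟩⟩
  · rintro φ (rfl | rfl | h)
    exacts [InLang.inst hψ hθ.2 (hSC hcS), hθ, hFC φ h]
  · intro o ho h
    rw [Set.union_insert, Set.union_insert] at h
    -- The omitted sentence may itself contain the witness `c`. Written as χ(c), it weakens to
    -- ∃yχ(y), which is free of `c` and still in `O`; so ∃xψ alone would already derive a member of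
    -- `O`.
    obtain ⟨y, χ, hχ, rfl, hχc⟩ := (hO.inLang o ho).1.exists_eq_inst c
    have hcχ : c ∉ χ.consts := by simp [hχc]
    refine hθO _ (hO.ex c hcS y χ hχ hcχ ho) ?_
    have h' : Der (insert (ex x ψ) (A ∪ F)) (imp (ex x ψ) (ex y χ)) := by
      refine Der.exElim (d := c) hψ hc.1 (by simpa [consts] using hcχ) ?_
        ((h.intro (hψ.isSentence_inst c)).trans (.exIntro c hχ))
      rintro γ (rfl | h | h)
      exacts [hc.1, hAS γ h c hcS, hc.2 γ h]
    exact h'.mp (.hyp hθ.1)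
  · exact (Set.subset_insert _ _).trans (Set.subset_insert _ _)
  · rintro y χ h
    obtain ⟨rfl, rfl⟩ := (ex.injEq ..).mp h
    exact ⟨c, hSC hcS, Set.mem_insert _ _⟩

/-- Lindenbaum's lemma: a theory avoiding `O` extends to a saturated theory that is maximal
among those avoiding `O`. -/
theorem exists_saturated {C S : Set σ.Const} {A O : Set (Formula σ)} (hSC : S ⊆ C)
    (hS : S.Infinite) (hA : ∀ φ ∈ A, InLang C φ) (hAS : ∀ φ ∈ A, ∀ c ∈ S, c ∉ φ.consts)
    (hO : OmitSet C S O) (hAO : ∀ o ∈ O, ¬ Der A o) :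
    ∃ T, Saturated C T ∧ A ⊆ T ∧ (∀ o ∈ O, o ∉ T) ∧
      ∀ θ, InLang C θ → θ ∉ T → ∃ o ∈ O, imp θ o ∈ T := by
  have : Nonempty (Formula σ) := ⟨bot⟩
  obtain ⟨en, hen⟩ := exists_surjective_nat (Formula σ)
  let P := {F : Set (Formula σ) // F.Finite ∧ (∀ φ ∈ F, InLang C φ) ∧ ∀ o ∈ O, ¬ Der (A ∪ F) o}
  choose next hnext using fun (F : P) (θ : Formula σ) =>
    exists_extension_step hSC hS hAS hO F.2.1 F.2.2.1 F.2.2.2 θ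
  let G : ℕ → P := fun n => Nat.rec (motive := fun _ => P)
    ⟨∅, Set.finite_empty, by simp, by simpa using hAO⟩
    (fun n F => ⟨next F (en n), (hnext F (en n)).1⟩) n
  have hG : ∀ n, (G n).1 ⊆ (G (n + 1)).1 ∧ (InLang C (en n) →
      (en n ∈ (G (n + 1)).1 ∧ ∀ x ψ, en n = ex x ψ → ∃ c ∈ C, ψ.inst x c ∈ (G (n + 1)).1) ∨
      ∃ o ∈ O, Der (A ∪ (G n).1) (imp (en n) o)) := fun n => (hnext (G n) (en n)).2
  have hmono : Monotone fun n => A ∪ (G n).1 :=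
    monotone_nat_of_le_succ fun n => Set.union_subset_union_right A (hG n).1
  set T : Set (Formula σ) := ⋃ n, A ∪ (G n).1 with hT
  have hsub : ∀ n, A ∪ (G n).1 ⊆ T := fun n => Set.subset_iUnion (fun n => A ∪ (G n).1) n
  have hTO : ∀ o ∈ O, ¬ Der T o := fun o ho h => by
    obtain ⟨n, hn⟩ := h.exists_of_iUnion hmono
    exact (G n).2.2.2 o ho hn
  have hTC : ∀ φ ∈ T, InLang C φ := fun φ hφ => by
    obtain ⟨n, hn | hn⟩ := Set.mem_iUnion.1 hφ
    exacts [hA φ hn, (G n).2.2.1 φ hn]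
  -- Each sentence of the language is accepted or implies a member of `O`. Closure, maximality,
  -- primality and witnesses all rest on this dichotomy.
  have key : ∀ θ, InLang C θ → (θ ∈ T ∧ ∀ x ψ, θ = ex x ψ → ∃ c ∈ C, ψ.inst x c ∈ T) ∨
      ∃ o ∈ O, Der T (imp θ o) := fun θ hθ => by
    obtain ⟨n, rfl⟩ := hen θ
    rcases (hG n).2 hθ with ⟨h₁, h₂⟩ | ⟨o, ho, h⟩
    · refine Or.inl ⟨hsub (n + 1) (Or.inr h₁), fun x ψ h => ?_⟩
      obtain ⟨c, hc, h'⟩ := h₂ x ψ h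
      exact ⟨c, hc, hsub (n + 1) (Or.inr h')⟩
    · exact Or.inr ⟨o, ho, h.mono (hsub n)⟩
  have closed : ∀ φ, InLang C φ → Der T φ → φ ∈ T := fun φ hφ h => by
    rcases key φ hφ with h' | ⟨o, ho, h'⟩
    · exact h'.1
    · exact (hTO o ho (h'.mp h)).elim
  have maximal : ∀ θ, InLang C θ → θ ∉ T → ∃ o ∈ O, imp θ o ∈ T := fun θ hθ h => by
    rcases key θ hθ with h' | ⟨o, ho, h'⟩
    · exact (h h'.1).elim
    · exact ⟨o, ho, closed _ (inLang_imp.2 ⟨hθ, hO.inLang o ho⟩) h'⟩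
  have omits : ∀ o ∈ O, o ∉ T := fun o ho h => hTO o ho (.ax h (hO.inLang o ho).1)
  refine ⟨T, ⟨hTC, closed, fun h => ?_, fun φ ψ h => ?_, fun x φ h => ?_⟩,
    Set.subset_union_left.trans (hsub 0), omits, maximal⟩
  · obtain ⟨o, ho⟩ := hO.nonempty
    exact hTO o ho ((Der.ax h rfl).botElim (hO.inLang o ho).1)
  · by_contra! hn
    obtain ⟨h₁, h₂⟩ := inLang_or.1 (hTC _ h)
    obtain ⟨o, ho, hφ⟩ := maximal φ h₁ hn.1
    obtain ⟨o', ho', hψ⟩ := maximal ψ h₂ hn.2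
    have hs := (hO.inLang o ho).1
    have hs' := (hO.inLang o' ho').1
    refine hTO _ (hO.or o ho o' ho') (.mp (.orElim ?_ ?_) (.ax h (hTC _ h).1))
    · exact Der.trans (.ax hφ (hTC _ hφ).1) (.intro hs (.orLeft (.hyp hs) hs'))
    · exact Der.trans (.ax hψ (hTC _ hψ).1) (.intro hs' (.orRight hs (.hyp hs')))
  · rcases key _ (hTC _ h) with h' | ⟨o, ho, h'⟩
    · exact h'.2 x φ rfl
    · exact (hTO o ho (h'.mp (.ax h (hTC _ h).1))).elim

namespace Saturated

variable {C : Set σ.Const} {T : Set (Formula σ)} {φ ψ : Formula σ}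

theorem der (hT : Saturated C T) (h : φ ∈ T) : Der T φ := .ax h (hT.inLang φ h).1

theorem top_mem (hT : Saturated C T) : top ∈ T := hT.closed _ inLang_top .top

theorem and_mem (hT : Saturated C T) : and φ ψ ∈ T ↔ φ ∈ T ∧ ψ ∈ T := by
  constructor
  · intro h
    obtain ⟨h₁, h₂⟩ := inLang_and.1 (hT.inLang _ h)
    exact ⟨hT.closed _ h₁ (hT.der h).andLeft, hT.closed _ h₂ (hT.der h).andRight⟩
  · rintro ⟨h₁, h₂⟩
    exact hT.closed _ (inLang_and.2 ⟨hT.inLang _ h₁, hT.inLang _ h₂⟩)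
      (.andIntro (hT.der h₁) (hT.der h₂))

theorem or_mem (hT : Saturated C T) (h : InLang C (or φ ψ)) : or φ ψ ∈ T ↔ φ ∈ T ∨ ψ ∈ T := by
  refine ⟨hT.prime φ ψ, ?_⟩
  rintro (h' | h')
  · exact hT.closed _ h (.orLeft (hT.der h') (inLang_or.1 h).2.1)
  · exact hT.closed _ h (.orRight (inLang_or.1 h).1.1 (hT.der h'))

theorem mp_mem (hT : Saturated C T) (h : imp φ ψ ∈ T) (h' : φ ∈ T) : ψ ∈ T :=
  hT.closed _ (inLang_imp.1 (hT.inLang _ h)).2 ((hT.der h).mp (hT.der h'))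

end Saturated

/-! ### The modal relation between theories -/

/-- `U` is a possible modal successor of the theory `T` in the language with constants `C`. -/
def Step (C : Set σ.Const) (T U : Set (Formula σ)) : Prop :=
  (∀ φ, box φ ∈ T → φ ∈ U) ∧ ∀ φ ∈ U, InLang C φ → dia φ ∈ T

/-- The sentences necessary according to `T`. -/
def boxInv (T : Set (Formula σ)) : Set (Formula σ) := {φ | box φ ∈ T}

section

variable {C : Set σ.Const} {T : Set (Formula σ)}

theorem Saturated.boxInv_inLang (hT : Saturated C T) : ∀ φ ∈ boxInv T, InLang C φ :=
  fun φ h => inLang_box.1 (hT.inLang (box φ) h)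

theorem Saturated.top_mem_boxInv (hT : Saturated C T) : top ∈ boxInv T :=
  hT.closed _ (inLang_box.2 inLang_top) (.nec .top)

theorem Saturated.and_mem_boxInv (hT : Saturated C T) :
    ∀ φ ∈ boxInv T, ∀ ψ ∈ boxInv T, and φ ψ ∈ boxInv T := fun φ h ψ h' =>
  hT.closed _ (inLang_box.2 (inLang_and.2 ⟨hT.boxInv_inLang φ h, hT.boxInv_inLang ψ h'⟩))
    (.boxAnd (hT.der h) (hT.der h'))

theorem Saturated.exists_of_der_union_boxInv (hT : Saturated C T) {X : Set (Formula σ)}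
    {φ : Formula σ} (h : Der (X ∪ boxInv T) φ) : ∃ χ, box χ ∈ T ∧ Der X (imp χ φ) :=
  Der.exists_of_union (fun y hy => (hT.boxInv_inLang y hy).1) hT.top_mem_boxInv
    hT.and_mem_boxInv h

theorem Saturated.exists_of_der_union (hT : Saturated C T) {X : Set (Formula σ)}
    {φ : Formula σ} (h : Der (X ∪ T) φ) : ∃ χ ∈ T, Der X (imp χ φ) :=
  Der.exists_of_union (fun y hy => (hT.inLang y hy).1) hT.top_mem
    (fun _ h _ h' => hT.and_mem.2 ⟨h, h'⟩) h

/-- Sentences implying a sentence of the language of `T` that `T` takes to be impossible. -/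
theorem Saturated.omitSet_impossible (hT : Saturated C T) {C' S : Set σ.Const}
    (hS : ∀ c ∈ S, c ∉ C) :
    OmitSet C' S {θ | InLang C' θ ∧ ∃ δ, InLang C δ ∧ dia δ ∉ T ∧ Der ∅ (imp θ δ)} := by
  refine ⟨fun o ho => ho.1, ⟨bot, inLang_bot, bot, inLang_bot, fun h => ?_, .refl rfl⟩, ?_, ?_⟩
  · exact hT.consistent (hT.closed _ inLang_bot (.mp (.thm .diaBot) (hT.der h)))
  · rintro o ⟨ho, δ, hδ, hδT, h⟩ o' ⟨ho', δ', hδ', hδT', h'⟩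
    refine ⟨inLang_or.2 ⟨ho, ho'⟩, or δ δ', inLang_or.2 ⟨hδ, hδ'⟩, fun hd => ?_, .orElim ?_ ?_⟩
    · have := hT.closed (or (dia δ) (dia δ')) (inLang_or.2 ⟨hδ, hδ'⟩)
        (.mp (.andLeft (.thm (.diaOr hδ.1 hδ'.1))) (hT.der hd))
      rcases hT.prime _ _ this with h | h
      exacts [hδT h, hδT' h]
    · exact h.trans (.intro hδ.1 (.orLeft (.hyp hδ.1) hδ'.1))
    · exact h'.trans (.intro hδ'.1 (.orRight hδ.1 (.hyp hδ'.1)))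
  · rintro c hc x φ hφ hcφ ⟨ho, δ, hδ, hδT, h⟩
    exact ⟨⟨isSentence_ex.2 hφ, (consts_subset_inst x c φ).trans ho.2⟩, δ, hδ, hδT,
      .exElim (d := c) hφ hcφ (hδ.notMem (hS c hc)) (by simp) h⟩

/-- Existence of modal successors. -/
theorem Saturated.exists_step (hT : Saturated C T) {C' S : Set σ.Const} {A : Set (Formula σ)}
    (hC : C ⊆ C') (hSC : S ⊆ C') (hS : S.Infinite) (hSC' : ∀ c ∈ S, c ∉ C)
    (hA : ∀ φ ∈ A, InLang C' φ) (hAS : ∀ φ ∈ A, ∀ c ∈ S, c ∉ φ.consts)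
    (hcons : ∀ δ, InLang C δ → Der (A ∪ boxInv T) δ → dia δ ∈ T) :
    ∃ U, Saturated C' U ∧ A ⊆ U ∧ Step C T U := by
  have h₁ : ∀ φ ∈ A ∪ boxInv T, InLang C' φ := by
    rintro φ (h | h)
    exacts [hA φ h, (hT.boxInv_inLang φ h).mono hC]
  have h₂ : ∀ φ ∈ A ∪ boxInv T, ∀ c ∈ S, c ∉ φ.consts := by
    rintro φ (h | h) c hc
    exacts [hAS φ h c hc, (hT.boxInv_inLang φ h).notMem (hSC' c hc)]
  -- The □ half of `Step` is put among the premises; the ◇ half is secured by omission.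
  obtain ⟨U, hU, hAU, hO, -⟩ := exists_saturated hSC hS h₁ h₂ (hT.omitSet_impossible hSC') (by
    rintro o ⟨-, δ, hδ, hδT, h⟩ ho
    exact hδT (hcons δ hδ (h.of_empty.mp ho)))
  refine ⟨U, hU, Set.subset_union_left.trans hAU, fun φ h => hAU (Or.inr h), fun φ h h' => ?_⟩
  by_contra hd
  exact hO φ ⟨h'.mono hC, φ, h', hd, .refl h'.1⟩ h

/-- If φ together with the necessities of `T` derives δ, then `T` contains □(φ → δ), and ◇φ yields
◇δ. -/
theorem Saturated.exists_step_of_dia (hT : Saturated C T) {C' S : Set σ.Const} (hC : C ⊆ C')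
    (hSC : S ⊆ C') (hS : S.Infinite) (hSC' : ∀ c ∈ S, c ∉ C) {φ : Formula σ} (h : dia φ ∈ T) :
    ∃ U, Saturated C' U ∧ φ ∈ U ∧ Step C T U := by
  have hφ : InLang C φ := hT.inLang (dia φ) h
  obtain ⟨U, hU, hAU, h'⟩ := hT.exists_step (A := {φ}) hC hSC hS hSC'
    (by rintro _ rfl; exact hφ.mono hC) (by rintro _ rfl c hc; exact hφ.notMem (hSC' c hc)) (by
      intro δ hδ hd
      rw [Set.singleton_union] at hd
      exact hT.closed _ hδ (.diaBoxMp (hT.der h) (Der.box_of_boxInv (hd.intro hφ.1))))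
  exact ⟨U, hU, hAU rfl, h'⟩

end

/-- Existential quantification over finitely many constants. -/
theorem exists_quantified {S : Set σ.Const} {P : Formula σ → Prop}
    (hP : ∀ c ∈ S, ∀ x φ, OnePlace x φ → c ∉ φ.consts → P (φ.inst x c) → P (ex x φ))
    {χ : Formula σ} (hχ : χ.IsSentence) (h : P χ) :
    ∃ χ', P χ' ∧ χ'.IsSentence ∧ χ'.consts ⊆ χ.consts \ S := by
  -- Induction on the number of constants of χ in `S`; each step turns one of them into a bound
  -- variable.
  obtain ⟨n, hn⟩ : ∃ n, (χ.consts ∩ S).ncard = n := ⟨_, rfl⟩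
  induction n generalizing χ with
  | zero =>
    rw [Set.ncard_eq_zero (χ.consts_finite.subset Set.inter_subset_left)] at hn
    refine ⟨χ, h, hχ, fun c hc => ⟨hc, fun hcS => ?_⟩⟩
    exact Set.notMem_empty c (hn ▸ ⟨hc, hcS⟩)
  | succ n ih =>
    obtain ⟨c, hc, hcS⟩ : (χ.consts ∩ S).Nonempty :=
      Set.nonempty_of_ncard_ne_zero (by omega)
    obtain ⟨x, φ, hφ, rfl, hφc⟩ := hχ.exists_eq_inst c
    have hcφ : c ∉ φ.consts := by simp [hφc]
    obtain ⟨χ', h₁, h₂, h₃⟩ := ih (χ := ex x φ) (isSentence_ex.2 hφ) (hP c hcS x φ hφ hcφ h) (by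
      have : (ex x φ).consts ∩ S = ((φ.inst x c).consts ∩ S) \ {c} := by
        rw [show (ex x φ).consts = φ.consts from rfl, hφc]
        ext d; simp only [Set.mem_inter_iff, Set.mem_sdiff]; tauto
      rw [this, Set.ncard_sdiff_singleton_of_mem (Set.mem_inter hc hcS)]; omega)
    exact ⟨χ', h₁, h₂, h₃.trans (Set.sdiff_subset_sdiff_left (consts_subset_inst x c φ))⟩

/-! ### Languages indexed by levels and stages -/

/-- The constants of level at most `k` and stage at most `N`. -/
def lang (e : σ.Const ≃ ℕ × ℕ × σ.Const) (k N : ℕ) : Set σ.Const :=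
  {c | (e c).1 ≤ k ∧ (e c).2.1 ≤ N}

/-- The constants of level `k` and stage `N`. -/
def layer (e : σ.Const ≃ ℕ × ℕ × σ.Const) (k N : ℕ) : Set σ.Const :=
  {c | (e c).1 = k ∧ (e c).2.1 = N}

/-- The constants of `lang e k N'` that are generic over theories of stage `N` and may be used
as witnesses in an extension to stage `N'`. -/
def fresh (e : σ.Const ≃ ℕ × ℕ × σ.Const) (k N N' : ℕ) : Set σ.Const :=
  {c | N < (e c).2.1 ∧ (e c).2.1 ≤ N' ∧ ((e c).1 < k ∨ (e c).1 = k ∧ (e c).2.1 = N')}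

section

variable {e : σ.Const ≃ ℕ × ℕ × σ.Const} {k k' N N' : ℕ}

theorem lang_mono (hk : k ≤ k') (hN : N ≤ N') : lang e k N ⊆ lang e k' N' :=
  fun _ h => ⟨h.1.trans hk, h.2.trans hN⟩

theorem layer_subset_lang : layer e k N ⊆ lang e k N := fun _ h => ⟨h.1.le, h.2.le⟩

theorem layer_infinite : (layer e k N).Infinite := by
  have := σ.const_infinite
  refine Set.infinite_of_injective_forall_mem (f := fun c => e.symm (k, N, c)) ?_ ?_
  · intro c d h; simpa using h
  · intro c; simp [layer]

theorem layer_subset_fresh (h : N < N') : layer e k N' ⊆ fresh e k N N' :=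
  fun _ hc => ⟨hc.2 ▸ h, hc.2.le, Or.inr hc⟩

theorem fresh_notMem {c : σ.Const} (hc : c ∈ fresh e k N N') (k' : ℕ) : c ∉ lang e k' N :=
  fun h => absurd h.2 (not_le.2 hc.1)

end

/-! ### Extension of chains -/

/-- Sets of sentences closed downwards under `G`-provable implication, which can be omitted by
extensions of `G`. -/
structure OmitIdeal (C S : Set σ.Const) (G O : Set (Formula σ)) : Prop extends OmitSet C S O where
  down : ∀ θ, InLang C θ → ∀ o ∈ O, Der G (imp θ o) → θ ∈ O
  proper : ∀ o ∈ O, ¬ Der G o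

theorem OmitIdeal.anti {C S : Set σ.Const} {G G' O : Set (Formula σ)} (h : OmitIdeal C S G O)
    (hG : G' ⊆ G) : OmitIdeal C S G' O :=
  ⟨h.toOmitSet, fun θ hθ o ho h' => h.down θ hθ o ho (h'.mono hG),
    fun o ho h' => h.proper o ho (h'.mono hG)⟩

/-- The ideal generated by ψ over `G`. It is closed under quantifying constants of `S` because these
occur neither in `G` nor in ψ. Since `G` may be larger than the theory to be extended, the ideal can
also encode an assumption. -/
theorem omitIdeal_principal {C S : Set σ.Const} {G : Set (Formula σ)} {ψ : Formula σ}
    (hG : ∀ γ ∈ G, ∀ c ∈ S, c ∉ γ.consts) (hψ : InLang C ψ) (hψS : ∀ c ∈ S, c ∉ ψ.consts)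
    (h : ¬ Der G ψ) : OmitIdeal C S G {θ | InLang C θ ∧ Der G (imp θ ψ)} where
  inLang _ ho := ho.1
  nonempty := ⟨ψ, hψ, .refl hψ.1⟩
  or _ ho _ ho' := ⟨inLang_or.2 ⟨ho.1, ho'.1⟩, .orElim ho.2 ho'.2⟩
  ex c hc x φ hφ hcφ h := ⟨⟨isSentence_ex.2 hφ, (consts_subset_inst x c φ).trans h.1.2⟩,
    .exElim (d := c) hφ hcφ (hψS c hc) (fun γ hγ => hG γ hγ c hc) h.2⟩
  down _ hθ _ ho h := ⟨hθ, h.trans ho.2⟩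
  proper _ ho h' := h (ho.2.mp h')

/-- Sequences `T 0, …, T k` of saturated theories at stage `N`, each one a modal successor of the
preceding one. -/
structure Chain (e : σ.Const ≃ ℕ × ℕ × σ.Const) (k N : ℕ) (T : ℕ → Set (Formula σ)) : Prop where
  sat : ∀ i ≤ k, Saturated (lang e i N) (T i)
  step : ∀ i < k, Step (lang e i N) (T i) (T (i + 1))

section

variable {e : σ.Const ≃ ℕ × ℕ × σ.Const} {k N N' : ℕ} {T : ℕ → Set (Formula σ)}

theorem Chain.init (h : Chain e (k + 1) N T) : Chain e k N T :=
  ⟨fun i hi => h.sat i (by omega), fun i hi => h.step i (by omega)⟩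

theorem Chain.snoc (h : Chain e k N T) {U : Set (Formula σ)} (hU : Saturated (lang e (k + 1) N) U)
    (hTU : Step (lang e k N) (T k) U) : Chain e (k + 1) N (Function.update T (k + 1) U) := by
  refine ⟨fun i hi => ?_, fun i hi => ?_⟩
  · rcases hi.lt_or_eq with hi | rfl
    · rw [Function.update_of_ne hi.ne]; exact h.sat i (by omega)
    · rwa [Function.update_self]
  · rw [Function.update_of_ne hi.ne]
    rcases Nat.lt_or_eq_of_le (Nat.le_of_lt_succ hi) with hi | rfl
    · rw [Function.update_of_ne (by omega)]; exact h.step i hi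
    · rwa [Function.update_self]

/-- The sentences that have to be omitted at the level `k` in order to omit `O` at the next. -/
theorem OmitIdeal.pred (hT : Chain e (k + 1) N T) {O : Set (Formula σ)}
    (hO : OmitIdeal (lang e (k + 1) N') (fresh e (k + 1) N N') (T (k + 1)) O) :
    OmitIdeal (lang e k N') (fresh e k N N') (T k)
      {θ | InLang (lang e k N') θ ∧ ∃ χ ∈ O, InLang (lang e k N') χ ∧
        Der (T k) (imp θ (box χ))} where
  inLang o ho := ho.1
  nonempty := by
    obtain ⟨o, ho⟩ := hO.nonempty
    refine ⟨bot, inLang_bot, bot, hO.down bot inLang_bot o ho ?_, inLang_bot, ?_⟩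
    · exact .intro rfl (.botElim (.hyp rfl) (hO.inLang o ho).1)
    · exact .intro rfl (.botElim (.hyp rfl) rfl)
  or := by
    rintro o ⟨ho, χ, hχ, hχ', h⟩ o' ⟨ho', χ', hχO, hχ'', h'⟩
    refine ⟨inLang_or.2 ⟨ho, ho'⟩, or χ χ', hO.or χ hχ χ' hχO, inLang_or.2 ⟨hχ', hχ''⟩, ?_⟩
    exact .orElim (h.trans (.boxMono (.intro hχ'.1 (.orLeft (.hyp hχ'.1) hχ''.1))))
      (h'.trans (.boxMono (.intro hχ''.1 (.orRight hχ'.1 (.hyp hχ''.1)))))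
  ex := by
    rintro c hc x φ hφ hcφ ⟨ho, χ, hχO, hχ, h⟩
    -- With χ = θ(c), the consequent □θ(c) weakens to □∃yθ(y). This is free of `c`, so the
    -- antecedent may be quantified.
    obtain ⟨y, θ, hθ, rfl, hθc⟩ := hχ.1.exists_eq_inst c
    have hcθ : c ∉ θ.consts := by simp [hθc]
    have hc' : c ∈ fresh e (k + 1) N N' := by
      obtain ⟨h₁, h₂, h₃⟩ := hc; exact ⟨h₁, h₂, by omega⟩
    refine ⟨⟨isSentence_ex.2 hφ, (consts_subset_inst x c φ).trans ho.2⟩, ex y θ,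
      hO.ex c hc' y θ hθ hcθ hχO, ⟨isSentence_ex.2 hθ, (consts_subset_inst y c θ).trans hχ.2⟩, ?_⟩
    exact .exElim (d := c) hφ hcφ (by simpa [consts] using hcθ)
      (fun γ hγ => ((hT.sat k (by omega)).inLang γ hγ).notMem (fresh_notMem hc k))
      (h.trans (.boxMono (.exIntro c hθ)))
  down := by
    rintro θ hθ o ⟨ho, χ, hχO, hχ, h⟩ h'
    exact ⟨hθ, χ, hχO, hχ, h'.trans h⟩
  proper := by
    rintro o ⟨ho, χ, hχO, hχ, h⟩ h'
    -- Here `T k` derives □χ, but χ may contain constants of stages after `N`. Having level at most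
    -- `k`, they are all fresh for level `k + 1`; quantifying them keeps χ in `O` and its necessity
    -- derivable. The result is in the language of `T k`, so it passes to `T (k + 1)`, against
    -- properness of `O`.
    obtain ⟨χ', ⟨hχ'O, hχ'⟩, hs, hsub⟩ := exists_quantified (S := fresh e (k + 1) N N')
      (P := fun χ => χ ∈ O ∧ Der (T k) (box χ))
      (fun c hc x φ hφ hcφ h => ⟨hO.ex c hc x φ hφ hcφ h.1, (Der.boxMono (.exIntro c hφ)).mp h.2⟩)
      hχ.1 ⟨hχO, h.mp h'⟩
    have hL : InLang (lang e k N) χ' := by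
      refine ⟨hs, fun c hc => ?_⟩
      obtain ⟨hc₁, hc₂⟩ := hsub hc
      obtain ⟨h₁, h₂⟩ := hχ.2 hc₁
      refine ⟨h₁, not_lt.1 fun h₃ => hc₂ ⟨h₃, h₂, by omega⟩⟩
    have := (hT.step k (by omega)).1 χ' ((hT.sat k (by omega)).closed _ (inLang_box.2 hL) hχ')
    exact hO.proper χ' hχ'O (.ax this hs)

/-- A chain can be extended to a later stage so that its last member is maximal among the
theories omitting a given ideal. -/
theorem Chain.exists_extension (hT : Chain e k N T) (hN : N < N') {O : Set (Formula σ)}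
    (hO : OmitIdeal (lang e k N') (fresh e k N N') (T k) O) :
    ∃ T', Chain e k N' T' ∧ (∀ i ≤ k, T i ⊆ T' i) ∧ (∀ o ∈ O, o ∉ T' k) ∧
      ∀ θ, InLang (lang e k N') θ → θ ∉ T' k → ∃ o ∈ O, imp θ o ∈ T' k := by
  induction k generalizing O with
  | zero =>
    have hT0 := hT.sat 0 le_rfl
    obtain ⟨U, hU, hTU, hUO, hmax⟩ := exists_saturated layer_subset_lang
      (layer_infinite (e := e) (k := 0) (N := N'))
      (fun φ hφ => (hT0.inLang φ hφ).mono (lang_mono le_rfl hN.le))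
      (fun φ hφ c hc => (hT0.inLang φ hφ).notMem (fresh_notMem (layer_subset_fresh hN hc) 0))
      (hO.toOmitSet.anti (layer_subset_fresh hN)) hO.proper
    refine ⟨fun _ => U, ⟨fun i hi => ?_, fun i hi => by omega⟩, fun i hi => ?_, hUO, hmax⟩
    · obtain rfl : i = 0 := by omega
      exact hU
    · obtain rfl : i = 0 := by omega
      exact hTU
  | succ k ih =>
    obtain ⟨T', hT', hTT', homit, hmax⟩ := ih hT.init (hO.pred hT)
    have hTk := hT.sat (k + 1) le_rfl
    have hTk' := hT'.sat k le_rfl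
    have hsub : lang e k N' ⊆ lang e (k + 1) N' := lang_mono (Nat.le_succ k) le_rfl
    have h₁ : ∀ φ ∈ T (k + 1) ∪ boxInv (T' k), InLang (lang e (k + 1) N') φ := by
      rintro φ (h | h)
      exacts [(hTk.inLang φ h).mono (lang_mono le_rfl hN.le), (hTk'.boxInv_inLang φ h).mono hsub]
    have h₂ : ∀ φ ∈ T (k + 1) ∪ boxInv (T' k), ∀ c ∈ layer e (k + 1) N', c ∉ φ.consts := by
      rintro φ (h | h) c hc
      · exact (hTk.inLang φ h).notMem (fresh_notMem (layer_subset_fresh hN hc) _)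
      · exact (hTk'.boxInv_inLang φ h).notMem fun h' => by have := hc.1; have := h'.1; omega
    obtain ⟨U, hU, hTU, hUO, hmaxU⟩ := exists_saturated layer_subset_lang layer_infinite h₁ h₂
      (hO.toOmitSet.anti (layer_subset_fresh hN)) (by
        intro o ho h
        -- The necessities used merge into one χ with `T (k + 1)` deriving χ → o. Downward closure
        -- puts χ in `O`, so □χ was to be omitted at level `k`.
        obtain ⟨χ, hχT, hχ⟩ := hTk'.exists_of_der_union_boxInv h
        have hχL : InLang (lang e k N') χ := inLang_box.1 (hTk'.inLang _ hχT)
        exact homit (box χ) ⟨hχL, χ, hO.down χ (hχL.mono hsub) o ho hχ, hχL, .refl hχL.1⟩ hχT)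
    have hstep : Step (lang e k N') (T' k) U := by
      refine ⟨fun φ h => hTU (Or.inr h), fun δ hδ hδL => ?_⟩
      by_contra hd
      -- Maximality turns the absence of ◇δ into ◇δ → □χ with χ in `O`; `fs1` makes this □(δ → χ),
      -- which forces χ into `U`.
      obtain ⟨o, ⟨hoL, χ, hχO, hχ, h⟩, ho⟩ := hmax (dia δ) hδL hd
      have h' : Der (T' k) (imp (dia δ) (box χ)) := (hTk'.der ho).trans (h.mono (hTT' k le_rfl))
      have h'' := hTk'.closed (box (imp δ χ)) (inLang_imp.2 ⟨hδL, hχ⟩)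
        (.mp (.thm (.fs1 hδL.1 hχ.1)) h')
      exact hUO χ hχO (hU.mp_mem (hTU (Or.inr h'')) hδ)
    refine ⟨Function.update T' (k + 1) U, hT'.snoc hU hstep, fun i hi => ?_, ?_⟩
    · rcases hi.lt_or_eq with hi | rfl
      · rw [Function.update_of_ne hi.ne]; exact hTT' i (by omega)
      · rw [Function.update_self]; exact Set.subset_union_left.trans hTU
    · rw [Function.update_self]; exact ⟨hUO, hmaxU⟩

/-! ### Extensions and successors needed for the truth lemma -/

theorem Chain.fresh_notMem_consts (hT : Chain e k N T) :
    ∀ γ ∈ T k, ∀ c ∈ fresh e k N N', c ∉ γ.consts :=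
  fun γ hγ _ hc => ((hT.sat k le_rfl).inLang γ hγ).notMem (fresh_notMem hc k)

/-- Refutation of an implication in an extension. -/
theorem Chain.exists_of_imp_notMem (hT : Chain e k N T) {φ ψ : Formula σ}
    (hφψ : InLang (lang e k N) (imp φ ψ)) (h : imp φ ψ ∉ T k) :
    ∃ T', Chain e k (N + 1) T' ∧ (∀ i ≤ k, T i ⊆ T' i) ∧ φ ∈ T' k ∧ ψ ∉ T' k := by
  obtain ⟨hφ, hψ⟩ := inLang_imp.1 hφψ
  have hsub : lang e k N ⊆ lang e k (N + 1) := lang_mono le_rfl (Nat.le_succ N)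
  have hO := omitIdeal_principal (C := lang e k (N + 1)) (S := fresh e k N (N + 1))
    (G := insert φ (T k)) (ψ := ψ) (by
      rintro γ (rfl | hγ) c hc
      exacts [hφ.notMem (fresh_notMem hc k), hT.fresh_notMem_consts γ hγ c hc])
    (hψ.mono hsub) (fun c hc => hψ.notMem (fresh_notMem hc k))
    fun h' => h ((hT.sat k le_rfl).closed _ hφψ (h'.intro hφ.1))
  obtain ⟨T', hT', hTT', homit, hmax⟩ :=
    hT.exists_extension (Nat.lt_succ_self N) (hO.anti (Set.subset_insert φ (T k)))
  refine ⟨T', hT', hTT', ?_, homit ψ ⟨hψ.mono hsub, .refl hψ.1⟩⟩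
  -- The extension starts from `T k` without φ; the assumption φ enters only through the ideal. If φ
  -- were missing, maximality would give φ → o with o implying ψ under φ, hence φ → ψ. But φ → ψ
  -- lies in the ideal, since under φ it implies ψ.
  by_contra hφT
  obtain ⟨o, ho, h'⟩ := hmax φ (hφ.mono hsub) hφT
  have hT'k := hT'.sat k le_rfl
  have h'' : Der (T' k) (imp φ ψ) := by
    refine .intro hφ.1 (.mp (ho.2.mono (Set.insert_subset_insert (hTT' k le_rfl))) ?_)
    exact (hT'k.der h').elim
  refine homit (imp φ ψ) ⟨hφψ.mono hsub, .intro hφψ.1 ?_⟩ (hT'k.closed _ (hφψ.mono hsub) h'')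
  exact (Der.hyp hφψ.1).mp (Der.hyp hφ.1).weak

/-- Refutation of a necessity in an extension. -/
theorem Chain.exists_of_box_notMem (hT : Chain e k N T) {φ : Formula σ}
    (hφ : InLang (lang e k N) φ) (h : box φ ∉ T k) :
    ∃ T', Chain e (k + 1) (N + 1) T' ∧ (∀ i ≤ k, T i ⊆ T' i) ∧ φ ∉ T' (k + 1) := by
  have hsub : lang e k N ⊆ lang e k (N + 1) := lang_mono le_rfl (Nat.le_succ N)
  have hsub' : lang e k (N + 1) ⊆ lang e (k + 1) (N + 1) := lang_mono (Nat.le_succ k) le_rfl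
  have hO := omitIdeal_principal (C := lang e k (N + 1)) (S := fresh e k N (N + 1))
    (ψ := box φ) hT.fresh_notMem_consts (hφ.mono hsub) (fun c hc => hφ.notMem (fresh_notMem hc k))
    fun h' => h ((hT.sat k le_rfl).closed _ hφ h')
  obtain ⟨T', hT', hTT', homit, hmax⟩ := hT.exists_extension (Nat.lt_succ_self N) hO
  have hT'k := hT'.sat k le_rfl
  have hlayer : ∀ c ∈ layer e (k + 1) (N + 1), c ∉ lang e k (N + 1) := fun c hc h' => by
    have := hc.1; have := h'.1; omega
  have hbox : box φ ∉ T' k := homit (box φ) ⟨hφ.mono hsub, .refl hφ.1⟩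
  obtain ⟨U, hU, hTU, hUO, -⟩ := exists_saturated (A := boxInv (T' k)) layer_subset_lang
    layer_infinite (fun χ hχ => (hT'k.boxInv_inLang χ hχ).mono hsub')
    (fun χ hχ c hc => (hT'k.boxInv_inLang χ hχ).notMem (hlayer c hc))
    (omitIdeal_principal (G := ∅) (ψ := φ) (by simp) (hφ.mono (hsub.trans hsub'))
      (fun c hc => (hφ.mono hsub).notMem (hlayer c hc)) fun h' =>
        hbox (hT'k.closed _ (hφ.mono hsub) (.nec h'))).toOmitSet
    fun o ho h' => hbox (hT'k.closed _ (hφ.mono hsub)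
      (Der.box_of_boxInv (ho.2.of_empty.mp h')))
  have hφU : φ ∉ U := hUO φ ⟨hφ.mono (hsub.trans hsub'), .refl hφ.1⟩
  refine ⟨Function.update T' (k + 1) U, hT'.snoc hU ⟨fun χ hχ => hTU hχ, fun δ hδ hδL => ?_⟩,
    fun i hi => ?_, by rwa [Function.update_self]⟩
  · by_contra hd
    -- Maximality for the ideal of □φ gives ◇δ → □φ, hence □(δ → φ) by `fs1`, and φ would be in `U`.
    obtain ⟨o, ho, h'⟩ := hmax (dia δ) hδL hd
    have h'' := hT'k.closed (box (imp δ φ)) (inLang_imp.2 ⟨hδL, hφ.mono hsub⟩)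
      (.mp (.thm (.fs1 hδL.1 hφ.1)) ((hT'k.der h').trans (ho.2.mono (hTT' k le_rfl))))
    exact hφU (hU.mp_mem (hTU h'') hδ)
  · rw [Function.update_of_ne (by omega)]; exact hTT' i hi

/-- Refutation of a universal sentence in an extension. -/
theorem Chain.exists_of_all_notMem (hT : Chain e k N T) {x : ℕ} {φ : Formula σ}
    (hφ : InLang (lang e k N) (all x φ)) (h : all x φ ∉ T k) :
    ∃ T', Chain e k (N + 2) T' ∧ (∀ i ≤ k, T i ⊆ T' i) ∧
      ∃ c ∈ lang e k (N + 2), φ.inst x c ∉ T' k := by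
  -- The extension goes two stages up so that the counterexample `c`, at level `k` and the
  -- intermediate stage, is outside `fresh e k N (N + 2)`. The sentence φ(c) can then generate an
  -- ideal.
  obtain ⟨c, hc⟩ := (layer_infinite (e := e) (k := k) (N := N + 1)).nonempty
  have hcN : c ∉ lang e k N := fun h' => by have := h'.2; have := hc.2; omega
  have hφ₁ : OnePlace x φ := isSentence_all.1 hφ.1
  have hcφ : c ∉ φ.consts := fun h' => hcN (hφ.2 h')
  have hcL : c ∈ lang e k (N + 2) := ⟨hc.1.le, by have := hc.2; omega⟩
  have hL : InLang (lang e k (N + 2)) (φ.inst x c) :=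
    .inst hφ₁ (hφ.2.trans (lang_mono le_rfl (by omega))) hcL
  have hO := omitIdeal_principal (C := lang e k (N + 2)) (S := fresh e k N (N + 2))
    (ψ := φ.inst x c) hT.fresh_notMem_consts hL (fun d hd h' => by
      rcases consts_inst_subset x c φ h' with rfl | h'
      · obtain ⟨-, -, h | h⟩ := hd
        · exact absurd hc.1 h.ne
        · have := hc.2; omega
      · exact fresh_notMem hd k (hφ.2 h'))
    fun h' => h ((hT.sat k le_rfl).closed _ hφ (.gen (d := c) hφ₁ hcφ
      (fun γ hγ => ((hT.sat k le_rfl).inLang γ hγ).notMem hcN) h'))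
  obtain ⟨T', hT', hTT', homit, -⟩ := hT.exists_extension (by omega) hO
  exact ⟨T', hT', hTT', c, hcL, homit _ ⟨hL, .refl hL.1⟩⟩

/-- Modal successors of the last theory of a chain. -/
theorem Chain.exists_of_dia_mem (hT : Chain e k N T) {φ : Formula σ} (h : dia φ ∈ T k) :
    ∃ U, Saturated (lang e (k + 1) N) U ∧ φ ∈ U ∧ Step (lang e k N) (T k) U :=
  (hT.sat k le_rfl).exists_step_of_dia (lang_mono (Nat.le_succ k) le_rfl)
    (layer_subset_lang (k := k + 1)) layer_infinite
    (fun c hc h' => by have := hc.1; have := h'.1; omega) h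

/-- A modal successor of a theory extends to one of an extension of the theory. -/
theorem exists_step_extension (hN : N < N') {X X' Y : Set (Formula σ)}
    (hX' : Saturated (lang e k N') X') (hXX' : X ⊆ X')
    (hY : Saturated (lang e (k + 1) N) Y) (hXY : Step (lang e k N) X Y) :
    ∃ Y', Saturated (lang e (k + 1) N') Y' ∧ Y ⊆ Y' ∧ Step (lang e k N') X' Y' := by
  refine hX'.exists_step (lang_mono (Nat.le_succ k) le_rfl) (layer_subset_lang (k := k + 1))
    layer_infinite (fun c hc h' => by have := hc.1; have := h'.1; omega)
    (fun φ hφ => (hY.inLang φ hφ).mono (lang_mono le_rfl hN.le))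
    (fun φ hφ c hc => (hY.inLang φ hφ).notMem (fresh_notMem (layer_subset_fresh hN hc) _)) ?_
  intro δ hδ hd
  obtain ⟨χ, hχX, hχ⟩ := hX'.exists_of_der_union_boxInv hd
  have hχL : InLang (lang e k N') χ := inLang_box.1 (hX'.inLang _ hχX)
  have hχδ : InLang (lang e k N') (imp χ δ) := inLang_imp.2 ⟨hχL, hδ⟩
  rw [← Set.empty_union Y] at hχ
  obtain ⟨η, hη, hηχ⟩ := hY.exists_of_der_union hχ
  -- The sentence η of `Y` may use constants foreign to `X'`, but these do not occur in χ → δ and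
  -- can be quantified away. What remains has level at most `k` and stage at most `N`, so ◇η' is in
  -- `X`. Hence `X'` contains ◇(χ → δ), and `fs2` with □χ yields ◇δ.
  obtain ⟨η', ⟨hη', hη'χ⟩, hs, hsub⟩ := exists_quantified (S := {c | c ∉ lang e k N'})
    (P := fun η => η ∈ Y ∧ Der ∅ (imp η (imp χ δ))) (by
      rintro c hc x φ hφ hcφ ⟨h, h'⟩
      have hφY : InLang (lang e (k + 1) N) (ex x φ) :=
        ⟨isSentence_ex.2 hφ, (consts_subset_inst x c φ).trans (hY.inLang _ h).2⟩
      exact ⟨hY.closed _ hφY ((Der.exIntro c hφ).mp (hY.der h)),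
        .exElim (d := c) hφ hcφ (hχδ.notMem hc) (by simp) h'⟩) (hY.inLang η hη).1 ⟨hη, hηχ⟩
  have hη'L : InLang (lang e k N) η' := by
    refine ⟨hs, fun c hc => ?_⟩
    have h₁ : c ∈ lang e k N' := by simpa using (hsub hc).2
    exact ⟨h₁.1, ((hY.inLang η' hη').2 hc).2⟩
  have hdia : dia η' ∈ X' := hXX' (hXY.2 η' hη' hη'L)
  exact hX'.closed _ hδ (.diaMp ((Der.diaMono hη'χ).mp (hX'.der hdia)) (hX'.der hχX))

end

/-! ### Equality in saturated theories -/

namespace Saturated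

variable {C : Set σ.Const} {T : Set (Formula σ)}

theorem inLang_eq {a b : σ.Const} :
    InLang C (eq (.const a) (.const b)) ↔ a ∈ C ∧ b ∈ C := by
  simp [InLang, IsSentence, freeVars, Term.vars, consts, Term.consts, Set.insert_subset_iff,
    and_comm]

theorem eq_refl (hT : Saturated C T) {a : σ.Const} (ha : a ∈ C) :
    eq (.const a) (.const a) ∈ T :=
  hT.closed _ (inLang_eq.2 ⟨ha, ha⟩) (.thm (.idRef a))

theorem eq_subst (hT : Saturated C T) {a b : σ.Const} (h : eq (.const a) (.const b) ∈ T) {x : ℕ}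
    {φ : Formula σ} (hφ : OnePlace x φ) (hm : φ.ModalFree) (h' : φ.inst x a ∈ T) :
    φ.inst x b ∈ T := by
  have hL : InLang C (φ.inst x b) :=
    .inst hφ ((consts_subset_inst x a φ).trans (hT.inLang _ h').2) (inLang_eq.1 (hT.inLang _ h)).2
  exact hT.closed _ hL (.mp (.mp (.thm (.idSub a b hφ hm)) (hT.der h)) (hT.der h'))

theorem eq_symm (hT : Saturated C T) {a b : σ.Const} (h : eq (.const a) (.const b) ∈ T) :
    eq (.const b) (.const a) ∈ T := by
  have := hT.eq_subst h (x := 0) (φ := eq (.var 0) (.const a))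
    (by simp [OnePlace, freeVars, Term.vars]) trivial
  simp only [inst, Term.inst, if_true] at this
  exact this (hT.eq_refl (inLang_eq.1 (hT.inLang _ h)).1)

theorem eq_trans (hT : Saturated C T) {a b c : σ.Const} (h : eq (.const a) (.const b) ∈ T)
    (h' : eq (.const b) (.const c) ∈ T) : eq (.const a) (.const c) ∈ T := by
  have := hT.eq_subst h' (x := 0) (φ := eq (.const a) (.var 0))
    (by simp [OnePlace, freeVars, Term.vars]) trivial
  simp only [inst, Term.inst, if_true] at this
  exact this h

/-- The coordinates are exchanged one at a time, because the equality axiom substitutes for a single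
variable. -/
theorem rel_subst (hT : Saturated C T) {P : σ.Pred} {a b : Fin (σ.arity P) → σ.Const}
    (h : ∀ i, eq (.const (a i)) (.const (b i)) ∈ T) (ha : rel P (fun i => .const (a i)) ∈ T) :
    rel P (fun i => .const (b i)) ∈ T := by
  have key : ∀ s : Finset (Fin (σ.arity P)),
      rel P (fun i => .const (if i ∈ s then b i else a i)) ∈ T := fun s => by
    induction s using Finset.induction_on with
    | empty => simpa using ha
    | insert i s his ih =>
      have := hT.eq_subst (h i) (x := 0)
        (φ := rel P fun j => if j = i then .var 0 else .const (if j ∈ s then b j else a j)) (by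
          refine Set.iUnion_subset fun j => ?_
          by_cases hj : j = i <;> simp [hj, Term.vars]) trivial
      simp only [inst] at this
      convert this ?_ using 3 with j
      · by_cases hj : j = i <;> simp [hj, Term.inst]
      · convert ih using 3 with j
        by_cases hj : j = i <;> simp [hj, his, Term.inst]
  simpa using key Finset.univ

end Saturated

/-! ### The canonical model -/

/-- The worlds of the canonical model. -/
structure ChainWorld (e : σ.Const ≃ ℕ × ℕ × σ.Const) where
  depth : ℕ
  stage : ℕ
  theories : ℕ → Set (Formula σ)
  chain : Chain e depth stage theories

namespace ChainWorld

variable {e : σ.Const ≃ ℕ × ℕ × σ.Const}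

/-- The constants of the language of a world. -/
def dom (w : ChainWorld e) : Set σ.Const := lang e w.depth w.stage

/-- The sentences true at a world. -/
def theory (w : ChainWorld e) : Set (Formula σ) := w.theories w.depth

theorem sat (w : ChainWorld e) : Saturated w.dom w.theory := w.chain.sat _ le_rfl

/-- The intuitionistic order. -/
def le (w w' : ChainWorld e) : Prop :=
  w = w' ∨ w.stage < w'.stage ∧ w.depth = w'.depth ∧ ∀ i ≤ w.depth, w.theories i ⊆ w'.theories i

/-- The modal relation. -/
def acc (w v : ChainWorld e) : Prop :=
  v.depth = w.depth + 1 ∧ v.stage = w.stage ∧ ∀ i ≤ w.depth, v.theories i = w.theories i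

theorem dom_mono {w w' : ChainWorld e} (h : w.le w') : w.dom ⊆ w'.dom := by
  rcases h with rfl | ⟨h₁, h₂, -⟩
  · exact subset_rfl
  · exact lang_mono h₂.le h₁.le

theorem theory_mono {w w' : ChainWorld e} (h : w.le w') : w.theory ⊆ w'.theory := by
  rcases h with rfl | ⟨-, h₂, h₃⟩
  · exact subset_rfl
  · have := h₃ _ le_rfl
    rw [theory, theory, ← h₂]
    exact this

theorem acc_step {w v : ChainWorld e} (h : w.acc v) : Step w.dom w.theory v.theory := by
  obtain ⟨h₁, h₂, h₃⟩ := h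
  have := v.chain.step w.depth (by omega)
  rwa [h₂, h₃ _ le_rfl, ← h₁] at this

/-- Add a theory to a world. -/
def snoc (w : ChainWorld e) (U : Set (Formula σ))
    (hU : Saturated (lang e (w.depth + 1) w.stage) U) (h : Step w.dom w.theory U) :
    ChainWorld e :=
  ⟨w.depth + 1, w.stage, Function.update w.theories (w.depth + 1) U, w.chain.snoc hU h⟩

variable {w : ChainWorld e} {U : Set (Formula σ)}
  {hU : Saturated (lang e (w.depth + 1) w.stage) U} {h : Step w.dom w.theory U}

theorem acc_snoc : w.acc (w.snoc U hU h) :=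
  ⟨rfl, rfl, fun _ hi => Function.update_of_ne (by omega) _ _⟩

theorem theory_snoc : (w.snoc U hU h).theory = U := Function.update_self ..

theorem exists_acc_of_dia {φ : Formula σ} (h : dia φ ∈ w.theory) :
    ∃ v, w.acc v ∧ φ ∈ v.theory := by
  obtain ⟨U, hU, hφ, hs⟩ := w.chain.exists_of_dia_mem h
  exact ⟨w.snoc U hU hs, acc_snoc, theory_snoc.symm ▸ hφ⟩

/-- Seriality, from the instance of axiom D for ⊤. -/
theorem exists_acc (w : ChainWorld e) : ∃ v, w.acc v := by
  have h₁ : box top ∈ w.theory := w.sat.top_mem_boxInv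
  have h₂ : dia top ∈ w.theory :=
    w.sat.closed _ (inLang_dia.2 inLang_top) (.mp (.thm (.extra ⟨_, isSentence_top, rfl⟩))
      (w.sat.der h₁))
  obtain ⟨v, hv, -⟩ := exists_acc_of_dia h₂
  exact ⟨v, hv⟩

/-- (FC1): the required world is the larger chain with its last theory deleted. -/
theorem exists_le_acc {w v v' : ChainWorld e} (h : w.acc v) (h' : v.le v') :
    ∃ w', w.le w' ∧ w'.acc v' := by
  rcases h' with rfl | ⟨h₁, h₂, h₃⟩
  · exact ⟨w, Or.inl rfl, h⟩
  · obtain ⟨hd, hs, ht⟩ := h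
    have hd' : v'.depth = w.depth + 1 := h₂.symm.trans hd
    refine ⟨⟨w.depth, v'.stage, v'.theories, (hd' ▸ v'.chain : Chain e (w.depth + 1) _ _).init⟩,
      Or.inr ⟨by rw [← hs]; exact h₁, rfl, fun i hi => ?_⟩, hd', rfl, fun _ _ => rfl⟩
    rw [← ht i hi]
    exact h₃ i (by omega)

/-- (FC2): the chain of `w'` is prolonged by a theory that contains the last one of `v`. -/
theorem exists_acc_le {w w' v : ChainWorld e} (h : w.le w') (h' : w.acc v) :
    ∃ v', v.le v' ∧ w'.acc v' := by
  rcases h with rfl | ⟨h₁, h₂, h₃⟩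
  · exact ⟨v, Or.inl rfl, h'⟩
  · have hstep := acc_step h'
    obtain ⟨hd, hs, ht⟩ := h'
    have hY : Saturated (lang e (w.depth + 1) w.stage) v.theory := by
      have := v.sat
      rwa [dom, hd, hs] at this
    have hX' : Saturated (lang e w.depth w'.stage) w'.theory := by
      have := w'.sat
      rwa [dom, ← h₂] at this
    have hXX' : w.theory ⊆ w'.theory := theory_mono (Or.inr ⟨h₁, h₂, h₃⟩)
    obtain ⟨Y', hY', hYY', hs'⟩ := exists_step_extension h₁ hX' hXX' hY hstep
    refine ⟨w'.snoc Y' (by rwa [← h₂]) (by rwa [dom, ← h₂]),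
      Or.inr ⟨by rw [hs]; exact h₁, hd.trans (congrArg (· + 1) h₂), fun i hi => ?_⟩, acc_snoc⟩
    simp only [snoc]
    rcases hi.lt_or_eq with hi | rfl
    · rw [Function.update_of_ne (by omega), ht i (by omega)]
      exact h₃ i (by omega)
    · rw [show v.depth = w'.depth + 1 by omega, Function.update_self,
        ← show v.depth = w'.depth + 1 by omega]
      exact hYY'

end ChainWorld

/-- The canonical model. -/
def canonicalModel (e : σ.Const ≃ ℕ × ℕ × σ.Const) : Model σ where
  World := ChainWorld e
  le := ChainWorld.le
  acc := ChainWorld.acc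
  le_refl _ := Or.inl rfl
  le_trans := by
    rintro w w' w'' (rfl | ⟨h₁, h₂, h₃⟩) (rfl | ⟨h₁', h₂', h₃'⟩)
    · exact Or.inl rfl
    · exact Or.inr ⟨h₁', h₂', h₃'⟩
    · exact Or.inr ⟨h₁, h₂, h₃⟩
    · exact Or.inr ⟨h₁.trans h₁', h₂.trans h₂', fun i hi =>
        (h₃ i hi).trans (h₃' i (h₂ ▸ hi))⟩
  -- Entries beyond the depth of a world are arbitrary, so mutual inclusion up to the depth would
  -- not give equality; strict growth of the stage excludes a cycle.
  le_antisymm := by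
    rintro w w' (rfl | ⟨h₁, -⟩) (h | ⟨h₁', -⟩)
    exacts [rfl, rfl, h.symm, absurd h₁ h₁'.not_gt]
  fc1 _ _ _ := ChainWorld.exists_le_acc
  fc2 _ _ _ := ChainWorld.exists_acc_le
  Elem := σ.Const
  dom := ChainWorld.dom
  dom_le _ _ := ChainWorld.dom_mono
  dom_acc := by
    rintro w v ⟨h₁, h₂, -⟩
    exact lang_mono (by omega) h₂.ge
  eqv w a b := eq (.const a) (.const b) ∈ w.theory
  eqv_dom w _ _ h := Saturated.inLang_eq.1 (w.sat.inLang _ h)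
  eqv_refl w _ h := w.sat.eq_refl h
  eqv_symm w _ _ h := w.sat.eq_symm h
  eqv_trans w _ _ _ h h' := w.sat.eq_trans h h'
  eqv_le _ _ _ _ h h' := ChainWorld.theory_mono h h'
  -- Level 0 and stage 0 belong to the language of every world.
  cst c := e.symm (0, 0, c)
  cst_mem c w := by simp [ChainWorld.dom, lang]
  rel w P := {a | rel P (fun i => .const (a i)) ∈ w.theory}
  rel_dom w P a ha i :=
    (w.sat.inLang _ ha).2 (Set.mem_iUnion.2 ⟨i, rfl⟩)
  rel_le _ _ _ h _ ha := ChainWorld.theory_mono h ha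
  rel_eqv w _ _ _ h ha := w.sat.rel_subst h ha

/-! ### The truth lemma -/

section

variable (e : σ.Const ≃ ℕ × ℕ × σ.Const)

/-- The sentence expressing `φ` under the assignment `g`. -/
def closeBy (g : ℕ → σ.Const) (φ : Formula σ) : Formula σ :=
  φ.close (fun c => e.symm (0, 0, c)) fun x => some (g x)

theorem inst_closeBy (g : ℕ → σ.Const) (x : ℕ) (a : σ.Const) (φ : Formula σ) :
    (φ.close (fun c => e.symm (0, 0, c)) (Function.update (fun x => some (g x)) x none)).inst x a =
      closeBy e (Function.update g x a) φ := by
  rw [inst_close _ _ _ _ _ (Function.update_self ..), Function.update_idem, closeBy]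
  congr 1
  funext y
  by_cases hy : y = x
  · subst hy; simp
  · simp [hy, Function.update_of_ne]

theorem inLang_closeBy {w : ChainWorld e} {g : ℕ → σ.Const} (hg : ∀ x, g x ∈ w.dom)
    (φ : Formula σ) : InLang w.dom (closeBy e g φ) := by
  refine ⟨?_, consts_close_subset (fun c => by simp [ChainWorld.dom, lang]) ?_ φ⟩
  · unfold IsSentence closeBy; rw [freeVars_close]; simp
  · intro x c hc
    obtain rfl : g x = c := by simpa using hc
    exact hg x

theorem const_den (g : ℕ → σ.Const) (t : Term σ) :
    t.close (fun c => e.symm (0, 0, c)) (fun x => some (g x)) =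
      .const ((canonicalModel e).den g t) := by
  cases t <;> rfl

/-- Induction on the formula, for all worlds and assignments. The clauses for →, □ and ∀ obtain
counterexamples from the chain extensions; ◇ uses both halves of the modal relation, and ∃ the
witnesses. -/
theorem sat_iff_mem (w : ChainWorld e) (g : ℕ → σ.Const) (hg : ∀ x, g x ∈ w.dom)
    (φ : Formula σ) : (canonicalModel e).Sat w g φ ↔ closeBy e g φ ∈ w.theory := by
  have hupd : ∀ {w : ChainWorld e} {g : ℕ → σ.Const} {x : ℕ} {a : σ.Const},
      (∀ x, g x ∈ w.dom) → a ∈ w.dom → ∀ y, Function.update g x a y ∈ w.dom := by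
    intro w g x a hg ha y
    by_cases hy : y = x
    · subst hy; simpa using ha
    · simpa [hy, Function.update_of_ne] using hg y
  induction φ generalizing w g with
  | rel P ts =>
    simp only [closeBy, close, const_den]
    rfl
  | eq s t =>
    simp only [closeBy, close, const_den]
    rfl
  | bot => exact ⟨False.elim, w.sat.consistent⟩
  | and φ ψ h₁ h₂ => exact (and_congr (h₁ w g hg) (h₂ w g hg)).trans w.sat.and_mem.symm
  | or φ ψ h₁ h₂ =>
    exact (or_congr (h₁ w g hg) (h₂ w g hg)).trans
      (w.sat.or_mem (inLang_closeBy e hg (.or φ ψ))).symm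
  | imp φ ψ h₁ h₂ =>
    constructor
    · intro h
      by_contra hn
      obtain ⟨T', hT', hTT', hφ, hψ⟩ :=
        w.chain.exists_of_imp_notMem (inLang_closeBy e hg (.imp φ ψ)) hn
      let w' : ChainWorld e := ⟨w.depth, w.stage + 1, T', hT'⟩
      have hw : w.le w' := Or.inr ⟨Nat.lt_succ_self _, rfl, hTT'⟩
      have hg' := fun x => ChainWorld.dom_mono hw (hg x)
      exact hψ ((h₂ w' g hg').1 (h w' hw ((h₁ w' g hg').2 hφ)))
    · intro h w' hw hφ
      have hg' := fun x => ChainWorld.dom_mono hw (hg x)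
      exact (h₂ w' g hg').2
        (w'.sat.mp_mem (ChainWorld.theory_mono hw h) ((h₁ w' g hg').1 hφ))
  | box φ ih =>
    constructor
    · intro h
      by_contra hn
      obtain ⟨T', hT', hTT', hφ⟩ := w.chain.exists_of_box_notMem (inLang_closeBy e hg φ) hn
      -- One extended sequence, read up to two successive depths, gives both the later world and its
      -- modal successor.
      let w' : ChainWorld e := ⟨w.depth, w.stage + 1, T', hT'.init⟩
      let v' : ChainWorld e := ⟨w.depth + 1, w.stage + 1, T', hT'⟩
      have hw : w.le w' := Or.inr ⟨Nat.lt_succ_self _, rfl, hTT'⟩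
      have hv : w'.acc v' := ⟨rfl, rfl, fun _ _ => rfl⟩
      exact hφ ((ih v' g fun x => (canonicalModel e).dom_acc w' v' hv
        (ChainWorld.dom_mono hw (hg x))).1 (h w' v' hw hv))
    · intro h w' v' hw hv
      exact (ih v' g fun x => (canonicalModel e).dom_acc w' v' hv
        (ChainWorld.dom_mono hw (hg x))).2
          ((ChainWorld.acc_step hv).1 _ (ChainWorld.theory_mono hw h))
  | dia φ ih =>
    constructor
    · rintro ⟨v, hv, h⟩
      exact (ChainWorld.acc_step hv).2 _
        ((ih v g fun x => (canonicalModel e).dom_acc w v hv (hg x)).1 h) (inLang_closeBy e hg φ)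
    · intro h
      obtain ⟨v, hv, hφ⟩ := ChainWorld.exists_acc_of_dia h
      exact ⟨v, hv, (ih v g fun x => (canonicalModel e).dom_acc w v hv (hg x)).2 hφ⟩
  | all x φ ih =>
    have hL := inLang_closeBy e hg (.all x φ)
    constructor
    · intro h
      by_contra hn
      obtain ⟨T', hT', hTT', a, ha, hφ⟩ := w.chain.exists_of_all_notMem hL hn
      let w' : ChainWorld e := ⟨w.depth, w.stage + 2, T', hT'⟩
      have hw : w.le w' := Or.inr ⟨by simp [w'], rfl, hTT'⟩
      rw [inst_closeBy] at hφ
      exact hφ ((ih w' _ (hupd (fun y => ChainWorld.dom_mono hw (hg y)) ha)).1 (h w' hw a ha))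
    · intro h (w' : ChainWorld e) hw (a : σ.Const) ha
      have hg' := fun y => ChainWorld.dom_mono hw (hg y)
      refine (ih w' _ (hupd hg' ha)).2 ?_
      refine w'.sat.closed _ (inLang_closeBy e (hupd hg' ha) φ) ?_
      rw [← inst_closeBy]
      exact (Der.thm (.univ a (isSentence_all.1 hL.1))).mp
        (w'.sat.der (ChainWorld.theory_mono hw h))
  | ex x φ ih =>
    have hL := inLang_closeBy e hg (.ex x φ)
    constructor
    · rintro ⟨(a : σ.Const), ha, h⟩
      have h' := (ih w _ (hupd hg ha)).1 h
      rw [← inst_closeBy] at h'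
      exact w.sat.closed _ hL ((Der.exIntro a (isSentence_ex.1 hL.1)).mp (w.sat.der h'))
    · intro h
      obtain ⟨a, ha, h'⟩ := w.sat.witness _ _ h
      rw [inst_closeBy] at h'
      exact ⟨a, ha, (ih w _ (hupd hg ha)).2 h'⟩

theorem closeBy_of_isSentence (g : ℕ → σ.Const) {φ : Formula σ} (h : φ.IsSentence) :
    closeBy e g φ = φ.rename fun c => e.symm (0, 0, c) :=
  close_congr (fun _ _ => rfl) fun x hx => by
    rw [show φ.freeVars = ∅ from h] at hx; exact hx.elim

theorem trueAt_iff_mem (w : ChainWorld e) {φ : Formula σ} (h : φ.IsSentence) :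
    (canonicalModel e).TrueAt w φ ↔ (φ.rename fun c => e.symm (0, 0, c)) ∈ w.theory := by
  constructor
  · intro h'
    obtain ⟨a⟩ := σ.const_infinite.nonempty
    have hg : ∀ _ : ℕ, e.symm (0, 0, a) ∈ w.dom := fun _ => (canonicalModel e).cst_mem a w
    rw [← closeBy_of_isSentence e (fun _ => e.symm (0, 0, a)) h]
    exact (sat_iff_mem e w _ hg φ).1 (h' _ hg)
  · intro h' g hg
    rw [← closeBy_of_isSentence e g h] at h'
    exact (sat_iff_mem e w g hg φ).2 h'

/-! ### Return to the original language -/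

theorem rename_base_retract (φ : Formula σ) :
    (φ.rename fun c => e.symm (0, 0, c)).rename (fun c => (e c).2.2) = φ := by
  rw [rename_rename]
  convert rename_id φ using 2
  funext c; simp

/-- The map of constants that undoes the embedding is far from injective, so invariance of
provability under arbitrary maps is needed here. -/
theorem der_of_rename {Γ : Set (Formula σ)} {φ : Formula σ}
    (h : Der ((rename fun c => e.symm (0, 0, c)) '' Γ) (φ.rename fun c => e.symm (0, 0, c))) :
    Der Γ φ := by
  obtain ⟨l, hl, h⟩ := h.exists_conj
  have h' := h.rename axiomD_rename fun c => (e c).2.2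
  rw [rename_imp, rename_conj, rename_base_retract] at h'
  refine .mp (.thm h') (.conj fun γ hγ => ?_)
  obtain ⟨δ, hδ, rfl⟩ := List.mem_map.1 hγ
  obtain ⟨⟨η, hη, rfl⟩, hs⟩ := hl δ hδ
  rw [rename_base_retract]
  exact .ax hη (isSentence_rename.1 hs)

/-- A theory and a sentence it does not derive are separated by a world. -/
theorem exists_world {Γ : Set (Formula σ)} {φ : Formula σ} (hΓ : ∀ γ ∈ Γ, γ.IsSentence)
    (hφ : φ.IsSentence) (h : ¬ Der Γ φ) :
    ∃ w : ChainWorld e, (∀ γ ∈ Γ, (γ.rename fun c => e.symm (0, 0, c)) ∈ w.theory) ∧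
      (φ.rename fun c => e.symm (0, 0, c)) ∉ w.theory := by
  have hL : ∀ {γ : Formula σ}, γ.IsSentence →
      InLang (lang e 0 0) (γ.rename fun c => e.symm (0, 0, c)) := fun hγ =>
    ⟨isSentence_rename.2 hγ, consts_close_subset (fun c => by simp [lang]) (by simp) _⟩
  have hsub : lang e 0 0 ⊆ lang e 0 1 := lang_mono le_rfl zero_le_one
  have hlayer : ∀ c ∈ layer e 0 1, c ∉ lang e 0 0 := fun c hc h' => by
    have := hc.2; have := h'.2; omega
  -- The premises may use up all constants of stage 0, so witnesses come from stage 1, where the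
  -- separating world lies.
  obtain ⟨U, hU, hΓU, hUO, -⟩ := exists_saturated
    (A := (rename fun c => e.symm (0, 0, c)) '' Γ) (layer_subset_lang (e := e) (k := 0) (N := 1))
    layer_infinite (by rintro _ ⟨γ, hγ, rfl⟩; exact (hL (hΓ γ hγ)).mono hsub)
    (by rintro _ ⟨γ, hγ, rfl⟩ c hc; exact (hL (hΓ γ hγ)).notMem (hlayer c hc))
    (omitIdeal_principal (G := ∅) (ψ := φ.rename fun c => e.symm (0, 0, c)) (by simp)
      ((hL hφ).mono hsub) (fun c hc => (hL hφ).notMem (hlayer c hc))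
      fun h' => h (der_of_rename e h'.of_empty)).toOmitSet
    (fun o ho h' => h (der_of_rename e (ho.2.of_empty.mp h')))
  refine ⟨⟨0, 1, fun _ => U, fun i hi => ?_, fun i hi => by omega⟩,
    fun γ hγ => hΓU ⟨γ, hγ, rfl⟩, hUO _ ⟨(hL hφ).mono hsub, .refl (hL hφ).1⟩⟩
  obtain rfl : i = 0 := by omega
  exact hU

end

end FOFS

theorem mainTheorem5 (σ : FOFS.Signature.{u}) (Γ : Set (FOFS.Formula σ)) (φ : FOFS.Formula σ)
    (hΓ : ∀ γ ∈ Γ, γ.IsSentence) (hφ : φ.IsSentence)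
    (h : FOFS.Entails FOFS.Frame.Serial Γ φ) :
    FOFS.Derives (FOFS.axiomD σ) Γ φ := by
  have := σ.const_countable
  have := σ.const_infinite
  obtain ⟨e⟩ : Nonempty (σ.Const ≃ ℕ × ℕ × σ.Const) := nonempty_equiv_of_countable
  rw [FOFS.derives_iff_der hΓ]
  by_contra hn
  obtain ⟨w, hw, hwφ⟩ := FOFS.exists_world e hΓ hφ hn
  refine hwφ ((FOFS.trueAt_iff_mem e w hφ).1 (h (FOFS.canonicalModel e) ?_ w fun γ hγ => ?_))
  · exact FOFS.ChainWorld.exists_acc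
  · exact (FOFS.trueAt_iff_mem e w (hΓ γ hγ)).2 (hw γ hγ)
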